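/- **Mollifiers.** For $q\in\mathbb N$ let $\mathcal A_q(\mathbb R)$ be the set of even real-valued $\chi\in\mathcal D(\mathbb R)$ that are constant near $0$ and satisfy $\int_0^\infty\chi=\tfrac12$ and $\int_0^\infty x^{j/m}\chi(x)\,dx=0$ for $1\le j,m\le q$. Let $\mathcal A_q=\mathcal A_q(\mathbb C)$ be the set of functions $\varphi(x+iy)=\chi(x)\chi(y)$ with $\chi\in\mathcal A_q(\mathbb R)$. Put $\varphi_\varepsilon(z)=\varepsilon^{-2}\varphi(z/\varepsilon)$ for $\varepsilon>0$, let $i(\varphi)$ be the diameter of $\operatorname{supp}\varphi$, and let $\Gamma$ be the set of strictly increasing sequences $\gamma:\mathbb N\to[0,\infty)$ with $\gamma(n)\to\infty$. **Moderate and negligible families.** A family $(g_\varphi)_{\varphi\in\mathcal A_0}$ of nonnegative numbers is *moderate* if there is $N\in\mathbb N$ such that for all $\varphi\in\mathcal A_N$ there are $c>0$, $\eta\in\,]0,1]$ with $g_{\varphi_\varepsilon}\le c\,\varepsilon^{-N}$ for all $\varepsilon\in\,]0,\eta[$. It is *negligible* if there are $N\in\mathbb N$, $\gamma\in\Gamma$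 such that for all $q\ge N$ and $\varphi\in\mathcal A_q$ there are $c>0$, $\eta\in\,]0,1]$ with $g_{\varphi_\varepsilon}\le c\,\varepsilon^{\gamma(q)-N}$ for all $\varepsilon\in\,]0,\eta[$. **Generalized numbers.** $\overline{\mathbb C}$ is the ring of families $(x_\varphi)_{\varphi\in\mathcal A_0}$ in $\mathbb C$ with $(|x_\varphi|)$ moderate, modulo those with $(|x_\varphi|)$ negligible. Such a family is associated to zero if for some $p\in\mathbb N$ one has $\lim_{\varepsilon\downarrow0}x_{\varphi_\varepsilon}=0$ for all $\varphi\in\mathcal A_p$. Put $V(x)=\sup\{r\in\mathbb R: (i(\varphi)^{-r}x_\varphi)_\varphi\text{ is associated to zero}\}$ and $\|x\|=e^{-V(x)}$; the distance $\|x-y\|$ defines the sharp topology of $\overline{\mathbb C}$. **Generalized functions.** Let $\Omega\subset\mathbb C$ be open and nonempty. $\mathcal G(\Omega)$ is the ring of families $(u_\varphi)_{\varphi\in\mathcal A_0}$ of smooth functions $\Omega\to\mathbb C$ (smooth in the real sense) such that $(\sup_K|\partial^\alpha u_\varphi|)_\varphi$ is moderate for all $\alpha\in\mathbb N^2$ and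 all compact $K\subset\Omega$, modulo those for which all these families are negligible. $\mathcal{HG}(\Omega)$ is the set of $f\in\mathcal G(\Omega)$ with $\partial f/\partial\bar z=0$ in $\mathcal G(\Omega)$. **Point values.** $\tilde\Omega_c\subset\overline{\mathbb C}$ is the set of classes of moderate families $(x_\varphi)$ in $\Omega$ for which there are a compact $K\subset\Omega$ and $p\in\mathbb N$ such that for all $\varphi\in\mathcal A_p$ one has $x_{\varphi_\varepsilon}\in K$ for all sufficiently small $\varepsilon>0$; such a family is called compactly supported. For $f=[(u_\varphi)]\in\mathcal G(\Omega)$ let $\kappa(f):\tilde\Omega_c\to\overline{\mathbb C}$ be the (well-defined) map $[(x_\varphi)]\mapsto[(u_\varphi(x_\varphi))]$, for compactly supported representatives $(x_\varphi)$. **Analyticity.** A function $F:U\to\overline{\mathbb C}$ on an open set $U\subset\overline{\mathbb C}$ is analytic if for every $z_0\in U$ there are $a_n\in\overline{\mathbb C}$ $(n\in\mathbb N)$ and $R>0$ such that the ball $\{z:\|z-z_0\|<R\}$ lies in $U$ and, for each $z$ in it, $\sum_{n\ge0}a_n(z-z_0)^n$ converges to $F(z)$ in the sharp topology. **Sub-linearity.**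 $f\in\mathcal G(\Omega)$ is sub-linear if it has a representative $(u_\varphi)$ such that for every $x\in\tilde\Omega_c$ there are a compactly supported representative $(x_\varphi)$ of $x$, a number $k\in\mathbb R$, a sequence $(p_n)_{n\in\mathbb N}$ in $\mathbb R$ with $\lim_{n\to\infty}(p_n+kn)=\infty$ and a sequence $(N_n)_{n\in\mathbb N}$ in $\mathbb N$ such that for all $n\in\mathbb N$ and all $\varphi\in\mathcal A_{N_n}$ there are $C>0$ and $\eta\in\,]0,1]$ with $$\Big|\Big(\frac{\partial^n}{\partial z^n}u_{\varphi_\varepsilon}\Big)(x_{\varphi_\varepsilon})\Big|\le C\,\varepsilon^{p_n}\qquad\text{for all }\varepsilon\in\,]0,\eta[ .$$ **Statement.** Let $f\in\mathcal{HG}(\Omega)$. Then $\kappa(f)$ is analytic on $\tilde\Omega_c$ if and only if $f$ is sub-linear. -/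

import Mathlib

open scoped ContDiff Topology

namespace Colombeau

/-! ### Mollifiers -/

/-- `IsMollifier q χ` : the function `χ` belongs to `𝒜_q(ℝ)`. It is an even test function that is
constant near the origin, with `∫₀^∞ χ = 1/2` and `∫₀^∞ x^(j/m) χ(x) dx = 0` for `1 ≤ j, m ≤ q`. -/
structure IsMollifier (q : ℕ) (χ : ℝ → ℝ) : Prop where
  smooth : ContDiff ℝ ∞ χ
  compact : HasCompactSupport χ
  even : ∀ x, χ (-x) = χ x
  const : ∃ c : ℝ, ∀ᶠ x in 𝓝 (0 : ℝ), χ x = c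
  mass : ∫ x in Set.Ioi (0 : ℝ), χ x = 1 / 2
  moment : ∀ j m : ℕ, 1 ≤ j → j ≤ q → 1 ≤ m → m ≤ q →
    ∫ x in Set.Ioi (0 : ℝ), x ^ ((j : ℝ) / (m : ℝ)) * χ x = 0

/-- Membership in `𝒜_q(ℂ)`, where `ℂ = ℝ²`: the functions `x + iy ↦ χ(x) χ(y)`, `χ ∈ 𝒜_q(ℝ)`. -/
def IsMollifier₂ (q : ℕ) (φ : ℂ → ℝ) : Prop :=
  ∃ χ : ℝ → ℝ, IsMollifier q χ ∧ ∀ z : ℂ, φ z = χ z.re * χ z.im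

/-- The index set `𝒜₀(ℂ)`. -/
def A0 : Type := {φ : ℂ → ℝ // IsMollifier₂ 0 φ}

/-- `𝒜_q(ℂ)` as a subset of `𝒜₀(ℂ)`. -/
def A (q : ℕ) : Set A0 := {φ | IsMollifier₂ q φ.1}

theorem IsMollifier.mono {p q : ℕ} (h : p ≤ q) {χ : ℝ → ℝ} (hχ : IsMollifier q χ) :
    IsMollifier p χ :=
  ⟨hχ.smooth, hχ.compact, hχ.even, hχ.const, hχ.mass,
    fun j m h1 h2 h3 h4 => hχ.moment j m h1 (h2.trans h) h3 (h4.trans h)⟩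

theorem A_anti {p q : ℕ} (h : p ≤ q) {φ : A0} (hφ : φ ∈ A q) : φ ∈ A p := by
  obtain ⟨χ, h1, h2⟩ := hφ
  exact ⟨χ, h1.mono h, h2⟩

theorem IsMollifier.scale {q : ℕ} {χ : ℝ → ℝ} (hχ : IsMollifier q χ) {ε : ℝ} (hε : 0 < ε) :
    IsMollifier q (fun x => ε⁻¹ * χ (ε⁻¹ * x)) := by
  have hε' : 0 < ε⁻¹ := inv_pos.2 hε
  refine ⟨contDiff_const.mul (hχ.smooth.comp (contDiff_const.mul contDiff_id)), ?_, ?_, ?_, ?_, ?_⟩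
  · have := hχ.compact.comp_homeomorph (Homeomorph.mulLeft₀ ε⁻¹ hε'.ne')
    exact this.mul_left (f := fun _ => ε⁻¹)
  · intro x
    rw [mul_neg, hχ.even]
  · obtain ⟨c, hc⟩ := hχ.const
    refine ⟨ε⁻¹ * c, ?_⟩
    have ht : Filter.Tendsto (fun x : ℝ => ε⁻¹ * x) (𝓝 0) (𝓝 0) := by
      have : Continuous (fun x : ℝ => ε⁻¹ * x) := by fun_prop
      simpa using this.tendsto 0
    filter_upwards [ht.eventually hc] with x hx
    rw [hx]
  · rw [MeasureTheory.integral_const_mul,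
      MeasureTheory.integral_comp_mul_left_Ioi (fun x => χ x) 0 hε', mul_zero, hχ.mass]
    simp only [inv_inv, smul_eq_mul]
    field_simp
  · intro j m h1 h2 h3 h4
    have key : ∀ x ∈ Set.Ioi (0 : ℝ), x ^ ((j : ℝ) / (m : ℝ)) * (ε⁻¹ * χ (ε⁻¹ * x)) =
        (ε ^ ((j : ℝ) / (m : ℝ)) * ε⁻¹) *
          ((ε⁻¹ * x) ^ ((j : ℝ) / (m : ℝ)) * χ (ε⁻¹ * x)) := by
      intro x hx
      have hx' : (0 : ℝ) < x := hx
      rw [Real.mul_rpow hε'.le hx'.le, Real.inv_rpow hε.le]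
      have : ε ^ ((j : ℝ) / (m : ℝ)) ≠ 0 := (Real.rpow_pos_of_pos hε _).ne'
      field_simp
    rw [MeasureTheory.setIntegral_congr_fun measurableSet_Ioi key,
      MeasureTheory.integral_const_mul,
      MeasureTheory.integral_comp_mul_left_Ioi
        (fun x => x ^ ((j : ℝ) / (m : ℝ)) * χ x) 0 hε', mul_zero,
      hχ.moment j m h1 h2 h3 h4]
    simp

theorem IsMollifier₂.scale {q : ℕ} {φ : ℂ → ℝ} (hφ : IsMollifier₂ q φ) {ε : ℝ} (hε : 0 < ε) :
    IsMollifier₂ q (fun z => (ε ^ 2)⁻¹ * φ (z / (ε : ℂ))) := by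
  obtain ⟨χ, h1, h2⟩ := hφ
  refine ⟨_, h1.scale hε, fun z => ?_⟩
  beta_reduce
  rw [h2, Complex.div_ofReal_re, Complex.div_ofReal_im, div_eq_inv_mul, div_eq_inv_mul]
  ring

/-- `φ_ε(z) = ε⁻² φ(z/ε)` for `ε > 0`; the value for `ε ≤ 0` is irrelevant and never used. -/
noncomputable def A0.scale (φ : A0) (ε : ℝ) : A0 :=
  if h : 0 < ε then ⟨fun z => (ε ^ 2)⁻¹ * φ.1 (z / (ε : ℂ)), φ.2.scale h⟩ else φ

/-- `i(φ)`, the diameter of the support of `φ`. -/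
noncomputable def A0.diam (φ : A0) : ℝ := Metric.diam (tsupport φ.1)

/-! ### Moderate and negligible families

The families are indexed by `φ ∈ 𝒜₀(ℂ)`; the estimates are uniform over the set `S`. -/

/-- `∃ N, ∀ φ ∈ 𝒜_N, ∃ c > 0, ∃ η ∈ ]0,1], ∀ ε ∈ ]0,η[, sup_S g(φ_ε) ≤ c ε^(-N)`. -/
def IsModerate {X : Type} (S : Set X) (g : A0 → X → ℝ) : Prop :=
  ∃ N : ℕ, ∀ φ ∈ A N, ∃ c : ℝ, 0 < c ∧ ∃ η ∈ Set.Ioc (0 : ℝ) 1, ∀ ε ∈ Set.Ioo 0 η, ∀ x ∈ S,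
    g (φ.scale ε) x ≤ c * ε ^ (-(N : ℝ))

/-- The set `Γ` of strictly increasing sequences of nonnegative reals that tend to infinity. -/
def Gam : Set (ℕ → ℝ) :=
  {γ | (∀ n, 0 ≤ γ n) ∧ StrictMono γ ∧ Filter.Tendsto γ Filter.atTop Filter.atTop}

/-- `∃ N, ∃ γ ∈ Γ, ∀ q ≥ N, ∀ φ ∈ 𝒜_q, ∃ c > 0, ∃ η ∈ ]0,1], ∀ ε ∈ ]0,η[,
sup_S g(φ_ε) ≤ c ε^(γ(q)-N)`. -/
def IsNegligible {X : Type} (S : Set X) (g : A0 → X → ℝ) : Prop :=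
  ∃ N : ℕ, ∃ γ ∈ Gam, ∀ q, N ≤ q → ∀ φ ∈ A q, ∃ c : ℝ, 0 < c ∧ ∃ η ∈ Set.Ioc (0 : ℝ) 1,
    ∀ ε ∈ Set.Ioo 0 η, ∀ x ∈ S, g (φ.scale ε) x ≤ c * ε ^ (γ q - (N : ℝ))

section basic

variable {X : Type} {S : Set X} {f g : A0 → X → ℝ}

theorem IsModerate.mono (hg : IsModerate S g) (h : ∀ φ, ∀ x ∈ S, f φ x ≤ g φ x) :
    IsModerate S f := by
  obtain ⟨N, hN⟩ := hg
  refine ⟨N, fun φ hφ => ?_⟩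
  obtain ⟨c, hc, η, hη, H⟩ := hN φ hφ
  exact ⟨c, hc, η, hη, fun ε hε x hx => (h _ x hx).trans (H ε hε x hx)⟩

theorem IsNegligible.mono (hg : IsNegligible S g) (h : ∀ φ, ∀ x ∈ S, f φ x ≤ g φ x) :
    IsNegligible S f := by
  obtain ⟨N, γ, hγ, hN⟩ := hg
  refine ⟨N, γ, hγ, fun q hq φ hφ => ?_⟩
  obtain ⟨c, hc, η, hη, H⟩ := hN q hq φ hφ
  exact ⟨c, hc, η, hη, fun ε hε x hx => (h _ x hx).trans (H ε hε x hx)⟩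

theorem isModerate_const (C : ℝ) : IsModerate S (fun _ _ => C) := by
  refine ⟨0, fun φ _ => ⟨|C| + 1, by positivity, 1, by simp, fun ε _ x _ => ?_⟩⟩
  simp only [Nat.cast_zero, neg_zero, Real.rpow_zero, mul_one]
  linarith [le_abs_self C]

theorem natCast_mem_Gam : (fun n : ℕ => (n : ℝ)) ∈ Gam :=
  ⟨fun n => n.cast_nonneg, Nat.strictMono_cast, tendsto_natCast_atTop_atTop⟩

theorem isNegligible_zero : IsNegligible S (fun _ _ => 0) := by
  refine ⟨0, _, natCast_mem_Gam, fun q _ φ _ => ⟨1, one_pos, 1, by simp, fun ε hε x _ => ?_⟩⟩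
  have := Real.rpow_nonneg hε.1.le ((q : ℝ) - ((0 : ℕ) : ℝ))
  linarith

theorem min_mem_Gam {γ₁ γ₂ : ℕ → ℝ} (h₁ : γ₁ ∈ Gam) (h₂ : γ₂ ∈ Gam) :
    (fun n => min (γ₁ n) (γ₂ n)) ∈ Gam := by
  refine ⟨fun n => le_min (h₁.1 n) (h₂.1 n), fun a b hab => ?_, ?_⟩
  · exact min_lt_min (h₁.2.1 hab) (h₂.2.1 hab)
  · rw [Filter.tendsto_atTop]
    intro b
    filter_upwards [h₁.2.2.eventually_ge_atTop b, h₂.2.2.eventually_ge_atTop b] with n h1 h2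
    exact le_min h1 h2

theorem IsModerate.add (hf : IsModerate S f) (hg : IsModerate S g) :
    IsModerate S (fun φ x => f φ x + g φ x) := by
  obtain ⟨N, hN⟩ := hf
  obtain ⟨M, hM⟩ := hg
  refine ⟨max N M, fun φ hφ => ?_⟩
  obtain ⟨c, hc, η, hη, H⟩ := hN φ (A_anti (le_max_left _ _) hφ)
  obtain ⟨d, hd, θ, hθ, K⟩ := hM φ (A_anti (le_max_right _ _) hφ)
  refine ⟨c + d, by positivity, min η θ, ⟨lt_min hη.1 hθ.1, (min_le_left _ _).trans hη.2⟩,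
    fun ε hε x hx => ?_⟩
  have h1 := H ε ⟨hε.1, hε.2.trans_le (min_le_left _ _)⟩ x hx
  have h2 := K ε ⟨hε.1, hε.2.trans_le (min_le_right _ _)⟩ x hx
  have hε1 : ε ≤ 1 := (hε.2.trans_le ((min_le_left _ _).trans hη.2)).le
  have e1 : ε ^ (-(N : ℝ)) ≤ ε ^ (-((max N M : ℕ) : ℝ)) :=
    Real.rpow_le_rpow_of_exponent_ge hε.1 hε1 (by
      have : N ≤ max N M := le_max_left _ _
      have : (N : ℝ) ≤ ((max N M : ℕ) : ℝ) := by exact_mod_cast this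
      linarith)
  have e2 : ε ^ (-(M : ℝ)) ≤ ε ^ (-((max N M : ℕ) : ℝ)) :=
    Real.rpow_le_rpow_of_exponent_ge hε.1 hε1 (by
      have : M ≤ max N M := le_max_right _ _
      have : (M : ℝ) ≤ ((max N M : ℕ) : ℝ) := by exact_mod_cast this
      linarith)
  rw [add_mul]
  exact add_le_add (h1.trans (mul_le_mul_of_nonneg_left e1 hc.le))
    (h2.trans (mul_le_mul_of_nonneg_left e2 hd.le))

theorem IsNegligible.add (hf : IsNegligible S f) (hg : IsNegligible S g) :
    IsNegligible S (fun φ x => f φ x + g φ x) := by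
  obtain ⟨N, γ, hγ, hN⟩ := hf
  obtain ⟨M, γ', hγ', hM⟩ := hg
  refine ⟨max N M, _, min_mem_Gam hγ hγ', fun q hq φ hφ => ?_⟩
  obtain ⟨c, hc, η, hη, H⟩ := hN q ((le_max_left _ _).trans hq) φ hφ
  obtain ⟨d, hd, θ, hθ, K⟩ := hM q ((le_max_right _ _).trans hq) φ hφ
  refine ⟨c + d, by positivity, min η θ, ⟨lt_min hη.1 hθ.1, (min_le_left _ _).trans hη.2⟩,
    fun ε hε x hx => ?_⟩
  have h1 := H ε ⟨hε.1, hε.2.trans_le (min_le_left _ _)⟩ x hx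
  have h2 := K ε ⟨hε.1, hε.2.trans_le (min_le_right _ _)⟩ x hx
  have hε1 : ε ≤ 1 := (hε.2.trans_le ((min_le_left _ _).trans hη.2)).le
  have a1 : (N : ℝ) ≤ ((max N M : ℕ) : ℝ) := by exact_mod_cast le_max_left N M
  have a2 : (M : ℝ) ≤ ((max N M : ℕ) : ℝ) := by exact_mod_cast le_max_right N M
  have e1 : ε ^ (γ q - (N : ℝ)) ≤ ε ^ (min (γ q) (γ' q) - ((max N M : ℕ) : ℝ)) :=
    Real.rpow_le_rpow_of_exponent_ge hε.1 hε1 (by linarith [min_le_left (γ q) (γ' q)])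
  have e2 : ε ^ (γ' q - (M : ℝ)) ≤ ε ^ (min (γ q) (γ' q) - ((max N M : ℕ) : ℝ)) :=
    Real.rpow_le_rpow_of_exponent_ge hε.1 hε1 (by linarith [min_le_right (γ q) (γ' q)])
  rw [add_mul]
  exact add_le_add (h1.trans (mul_le_mul_of_nonneg_left e1 hc.le))
    (h2.trans (mul_le_mul_of_nonneg_left e2 hd.le))

theorem IsModerate.mul (hf : IsModerate S f) (hg : IsModerate S g)
    (f0 : ∀ φ x, 0 ≤ f φ x) (g0 : ∀ φ x, 0 ≤ g φ x) :
    IsModerate S (fun φ x => f φ x * g φ x) := by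
  obtain ⟨N, hN⟩ := hf
  obtain ⟨M, hM⟩ := hg
  refine ⟨N + M, fun φ hφ => ?_⟩
  obtain ⟨c, hc, η, hη, H⟩ := hN φ (A_anti (Nat.le_add_right _ _) hφ)
  obtain ⟨d, hd, θ, hθ, K⟩ := hM φ (A_anti (Nat.le_add_left _ _) hφ)
  refine ⟨c * d, by positivity, min η θ, ⟨lt_min hη.1 hθ.1, (min_le_left _ _).trans hη.2⟩,
    fun ε hε x hx => ?_⟩
  have h1 := H ε ⟨hε.1, hε.2.trans_le (min_le_left _ _)⟩ x hx
  have h2 := K ε ⟨hε.1, hε.2.trans_le (min_le_right _ _)⟩ x hx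
  have e : ε ^ (-((N + M : ℕ) : ℝ)) = ε ^ (-(N : ℝ)) * ε ^ (-(M : ℝ)) := by
    rw [← Real.rpow_add hε.1]
    push_cast
    ring_nf
  calc _ ≤ (c * ε ^ (-(N : ℝ))) * (d * ε ^ (-(M : ℝ))) :=
        mul_le_mul h1 h2 (g0 _ _) ((f0 _ _).trans h1)
    _ = _ := by rw [e]; ring

theorem IsModerate.mul_negligible (hf : IsModerate S f) (hg : IsNegligible S g)
    (f0 : ∀ φ x, 0 ≤ f φ x) (g0 : ∀ φ x, 0 ≤ g φ x) :
    IsNegligible S (fun φ x => f φ x * g φ x) := by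
  obtain ⟨N, hN⟩ := hf
  obtain ⟨M, γ, hγ, hM⟩ := hg
  refine ⟨N + M, γ, hγ, fun q hq φ hφ => ?_⟩
  obtain ⟨c, hc, η, hη, H⟩ := hN φ (A_anti ((Nat.le_add_right _ _).trans hq) hφ)
  obtain ⟨d, hd, θ, hθ, K⟩ := hM q ((Nat.le_add_left _ _).trans hq) φ hφ
  refine ⟨c * d, by positivity, min η θ, ⟨lt_min hη.1 hθ.1, (min_le_left _ _).trans hη.2⟩,
    fun ε hε x hx => ?_⟩
  have h1 := H ε ⟨hε.1, hε.2.trans_le (min_le_left _ _)⟩ x hx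
  have h2 := K ε ⟨hε.1, hε.2.trans_le (min_le_right _ _)⟩ x hx
  have e : ε ^ (γ q - ((N + M : ℕ) : ℝ)) = ε ^ (-(N : ℝ)) * ε ^ (γ q - (M : ℝ)) := by
    rw [← Real.rpow_add hε.1]
    push_cast
    ring_nf
  calc _ ≤ (c * ε ^ (-(N : ℝ))) * (d * ε ^ (γ q - (M : ℝ))) :=
        mul_le_mul h1 h2 (g0 _ _) ((f0 _ _).trans h1)
    _ = _ := by rw [e]; ring

theorem isModerate_sum {ι : Type} (s : Finset ι) (F : ι → A0 → X → ℝ)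
    (h : ∀ i ∈ s, IsModerate S (F i)) : IsModerate S (fun φ x => ∑ i ∈ s, F i φ x) := by
  classical
  induction s using Finset.induction_on with
  | empty => simpa using isModerate_const (S := S) 0
  | insert a s ha ih =>
    simp only [Finset.sum_insert ha]
    exact (h a (Finset.mem_insert_self _ _)).add
      (ih fun i hi => h i (Finset.mem_insert_of_mem hi))

theorem isNegligible_sum {ι : Type} (s : Finset ι) (F : ι → A0 → X → ℝ)
    (h : ∀ i ∈ s, IsNegligible S (F i)) : IsNegligible S (fun φ x => ∑ i ∈ s, F i φ x) := by
  classical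
  induction s using Finset.induction_on with
  | empty => simpa using isNegligible_zero (S := S)
  | insert a s ha ih =>
    simp only [Finset.sum_insert ha]
    exact (h a (Finset.mem_insert_self _ _)).add
      (ih fun i hi => h i (Finset.mem_insert_of_mem hi))

end basic

/-! ### Generalized numbers -/

/-- Moderate families of complex numbers: `|x(φ_ε)| ≤ c ε^(-N)`. -/
def NumModerate (x : A0 → ℂ) : Prop := IsModerate (Set.univ : Set Unit) (fun φ _ => ‖x φ‖)

/-- Negligible families of complex numbers: `|x(φ_ε)| ≤ c ε^(γ(q)-N)`. -/
def NumNegligible (x : A0 → ℂ) : Prop := IsNegligible (Set.univ : Set Unit) (fun φ _ => ‖x φ‖)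

/-- The ring `ℰ_M(ℂ)` of moderate families of numbers. -/
def numModerate : Subring (A0 → ℂ) where
  carrier := {x | NumModerate x}
  mul_mem' {x y} hx hy := by
    have hx' : IsModerate (Set.univ : Set Unit) (fun φ _ => ‖x φ‖) := hx
    have hy' : IsModerate (Set.univ : Set Unit) (fun φ _ => ‖y φ‖) := hy
    exact (hx'.mul hy' (fun _ _ => norm_nonneg _) fun _ _ => norm_nonneg _).mono
      fun φ _ _ => norm_mul_le (x φ) (y φ)
  one_mem' := by
    have h : IsModerate (Set.univ : Set Unit) (fun _ _ => (1 : ℝ)) := isModerate_const 1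
    change IsModerate (Set.univ : Set Unit) (fun φ _ => ‖(1 : A0 → ℂ) φ‖)
    exact h.mono fun φ _ _ => by simp
  add_mem' {x y} hx hy := by
    have hx' : IsModerate (Set.univ : Set Unit) (fun φ _ => ‖x φ‖) := hx
    have hy' : IsModerate (Set.univ : Set Unit) (fun φ _ => ‖y φ‖) := hy
    exact (hx'.add hy').mono fun φ _ _ => norm_add_le (x φ) (y φ)
  zero_mem' := by
    have h : IsModerate (Set.univ : Set Unit) (fun _ _ => (0 : ℝ)) := isModerate_const 0
    change IsModerate (Set.univ : Set Unit) (fun φ _ => ‖(0 : A0 → ℂ) φ‖)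
    exact h.mono fun φ _ _ => by simp
  neg_mem' {x} hx := by
    have hx' : IsModerate (Set.univ : Set Unit) (fun φ _ => ‖x φ‖) := hx
    change IsModerate (Set.univ : Set Unit) (fun φ _ => ‖(-x) φ‖)
    exact hx'.mono fun φ _ _ => by simp

/-- The ideal `𝒩(ℂ)` of negligible families of numbers. -/
def numNegligible : Ideal numModerate where
  carrier := {x | NumNegligible x.1}
  add_mem' {x y} hx hy := by
    have hx' : IsNegligible (Set.univ : Set Unit) (fun φ _ => ‖x.1 φ‖) := hx
    have hy' : IsNegligible (Set.univ : Set Unit) (fun φ _ => ‖y.1 φ‖) := hy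
    exact (hx'.add hy').mono fun φ _ _ => norm_add_le (x.1 φ) (y.1 φ)
  zero_mem' := by
    have h : IsNegligible (Set.univ : Set Unit) (fun _ _ => (0 : ℝ)) := isNegligible_zero
    change IsNegligible (Set.univ : Set Unit) (fun φ _ => ‖(0 : A0 → ℂ) φ‖)
    exact h.mono fun φ _ _ => by simp
  smul_mem' x y hy := by
    have hx' : IsModerate (Set.univ : Set Unit) (fun φ _ => ‖x.1 φ‖) := x.2
    have hy' : IsNegligible (Set.univ : Set Unit) (fun φ _ => ‖y.1 φ‖) := hy
    exact (hx'.mul_negligible hy' (fun _ _ => norm_nonneg _) fun _ _ => norm_nonneg _).mono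
      fun φ _ _ => norm_mul_le (x.1 φ) (y.1 φ)

/-- The ring of full generalized complex numbers. -/
abbrev GenNum : Type := numModerate ⧸ numNegligible

/-- The class of a moderate family of numbers. -/
abbrev GenNum.mk (x : numModerate) : GenNum := Ideal.Quotient.mk numNegligible x

/-! ### The sharp topology -/

/-- The family `v` is associated to zero. -/
def AssocZero (v : A0 → ℂ) : Prop :=
  ∃ p : ℕ, ∀ φ ∈ A p, Filter.Tendsto (fun ε : ℝ => v (φ.scale ε)) (𝓝[>] 0) (𝓝 0)

/-- `A(x) = {r ∈ ℝ | α_{-r} x ≈ 0}`, where `α_r(φ) = i(φ)^r`. -/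
def GenNum.expSet (x : GenNum) : Set ℝ :=
  {r | ∃ v : numModerate, GenNum.mk v = x ∧
    AssocZero (fun φ => ((φ.diam ^ (-r) : ℝ) : ℂ) * v.1 φ)}

/-- The valuation `V(x) = sup A(x)`, which is `∞` for `x = 0`. -/
noncomputable def GenNum.valuation (x : GenNum) : EReal :=
  sSup ((fun r : ℝ => (r : EReal)) '' x.expSet)

/-- The sharp norm `‖x‖ = exp(-V(x))`; the distance of `x` and `y` is `‖x - y‖`. -/
noncomputable def GenNum.sharpNorm (x : GenNum) : ENNReal := EReal.exp (-x.valuation)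

/-- `F : U → GenNum` is analytic: around each `z₀ ∈ U` it is, on some ball of the sharp metric
contained in `U`, the sum of a power series that converges in the sharp metric. -/
def IsAnalytic (U : Set GenNum) (F : U → GenNum) : Prop :=
  ∀ z₀ : U, ∃ a : ℕ → GenNum, ∃ R : ℝ, 0 < R ∧
    ∀ z : GenNum, (z - z₀.1).sharpNorm < ENNReal.ofReal R → ∃ hz : z ∈ U,
      Filter.Tendsto
        (fun m : ℕ => ((∑ n ∈ Finset.range m, a n * (z - z₀.1) ^ n) - F ⟨z, hz⟩).sharpNorm)
        Filter.atTop (𝓝 0)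

/-! ### Generalized functions -/

section functions

variable (Ω : TopologicalSpace.Opens ℂ)

/-- Moderate families of smooth functions: on each compact subset of `Ω`, the derivatives of each
order satisfy the moderateness estimate. The values outside `Ω` play no role. -/
def FunModerate (u : A0 → ℂ → ℂ) : Prop :=
  (∀ φ, ContDiffOn ℝ ∞ (u φ) Ω) ∧ ∀ K : Set ℂ, IsCompact K → K ⊆ Ω → ∀ n : ℕ,
    IsModerate K (fun φ z => ‖iteratedFDeriv ℝ n (u φ) z‖)

/-- The negligibility condition: on each compact subset of `Ω`, the derivatives of each order
satisfy the negligibility estimate. -/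
def FunNegligible (u : A0 → ℂ → ℂ) : Prop :=
  ∀ K : Set ℂ, IsCompact K → K ⊆ Ω → ∀ n : ℕ,
    IsNegligible K (fun φ z => ‖iteratedFDeriv ℝ n (u φ) z‖)

variable {Ω}

theorem contDiffAt_of_mem {g : ℂ → ℂ} (hg : ContDiffOn ℝ ∞ g Ω) {z : ℂ} (hz : z ∈ Ω) (n : ℕ) :
    ContDiffAt ℝ n g z :=
  (hg.contDiffAt (Ω.isOpen.mem_nhds hz)).of_le (by exact_mod_cast le_top)

theorem norm_iteratedFDeriv_add_le' {g h : ℂ → ℂ} (hg : ContDiffOn ℝ ∞ g Ω)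
    (hh : ContDiffOn ℝ ∞ h Ω) {z : ℂ} (hz : z ∈ Ω) (n : ℕ) :
    ‖iteratedFDeriv ℝ n (g + h) z‖ ≤ ‖iteratedFDeriv ℝ n g z‖ + ‖iteratedFDeriv ℝ n h z‖ := by
  rw [iteratedFDeriv_add_apply (contDiffAt_of_mem hg hz n) (contDiffAt_of_mem hh hz n)]
  exact norm_add_le _ _

theorem norm_iteratedFDeriv_mul_le' {g h : ℂ → ℂ} (hg : ContDiffOn ℝ ∞ g Ω)
    (hh : ContDiffOn ℝ ∞ h Ω) {z : ℂ} (hz : z ∈ Ω) (n : ℕ) :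
    ‖iteratedFDeriv ℝ n (g * h) z‖ ≤ ∑ i ∈ Finset.range (n + 1),
      (n.choose i : ℝ) * (‖iteratedFDeriv ℝ i g z‖ * ‖iteratedFDeriv ℝ (n - i) h z‖) := by
  have := norm_iteratedFDerivWithin_mul_le (𝕜 := ℝ) (n := n) (N := ∞) hg hh
    Ω.isOpen.uniqueDiffOn hz (by exact_mod_cast le_top)
  simp only [iteratedFDerivWithin_of_isOpen _ Ω.isOpen hz] at this
  simp only [mul_assoc] at this
  exact this

variable (Ω)

/-- The ring `ℰ_M(Ω)` of moderate families of smooth functions. -/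
def funModerate : Subring (A0 → ℂ → ℂ) where
  carrier := {u | FunModerate Ω u}
  mul_mem' {u v} hu hv := by
    refine ⟨fun φ => (hu.1 φ).mul (hv.1 φ), fun K hK hKΩ n => ?_⟩
    refine IsModerate.mono (g := fun φ z => ∑ i ∈ Finset.range (n + 1), (n.choose i : ℝ) *
      (‖iteratedFDeriv ℝ i (u φ) z‖ * ‖iteratedFDeriv ℝ (n - i) (v φ) z‖)) ?_
      (fun φ z hz => norm_iteratedFDeriv_mul_le' (hu.1 φ) (hv.1 φ) (hKΩ hz) n)
    refine isModerate_sum _ _ fun i _ => ?_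
    exact (isModerate_const _).mul
      ((hu.2 K hK hKΩ i).mul (hv.2 K hK hKΩ (n - i)) (fun _ _ => norm_nonneg _)
        fun _ _ => norm_nonneg _) (fun _ _ => Nat.cast_nonneg _) fun _ _ => by positivity
  one_mem' := by
    refine ⟨fun φ => contDiffOn_const, fun K _ _ n => ?_⟩
    refine (isModerate_const 1).mono fun φ z _ => ?_
    have h1 : (1 : A0 → ℂ → ℂ) φ = fun _ => (1 : ℂ) := rfl
    rw [h1]
    rcases Nat.eq_zero_or_pos n with rfl | hn
    · rw [norm_iteratedFDeriv_zero]
      simp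
    · rw [iteratedFDeriv_const_of_ne hn.ne']
      simp
  add_mem' {u v} hu hv := by
    refine ⟨fun φ => (hu.1 φ).add (hv.1 φ), fun K hK hKΩ n => ?_⟩
    exact ((hu.2 K hK hKΩ n).add (hv.2 K hK hKΩ n)).mono
      fun φ z hz => norm_iteratedFDeriv_add_le' (hu.1 φ) (hv.1 φ) (hKΩ hz) n
  zero_mem' := by
    refine ⟨fun φ => contDiffOn_const, fun K _ _ n => ?_⟩
    refine (isModerate_const 0).mono fun φ z _ => ?_
    have h0 : (0 : A0 → ℂ → ℂ) φ = 0 := rfl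
    rw [h0]
    simp
  neg_mem' {u} hu := by
    refine ⟨fun φ => (hu.1 φ).neg, fun K hK hKΩ n => (hu.2 K hK hKΩ n).mono fun φ z _ => ?_⟩
    have : (-u) φ = -(u φ) := rfl
    rw [this, iteratedFDeriv_neg_apply, norm_neg]

/-- The ideal `𝒩(Ω)` of negligible families of functions. -/
def funNegligible : Ideal (funModerate Ω) where
  carrier := {u | FunNegligible Ω u.1}
  add_mem' {u v} hu hv := by
    intro K hK hKΩ n
    exact (IsNegligible.add (hu K hK hKΩ n) (hv K hK hKΩ n)).mono
      fun φ z hz => norm_iteratedFDeriv_add_le' (u.2.1 φ) (v.2.1 φ) (hKΩ hz) n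
  zero_mem' := by
    intro K _ _ n
    refine isNegligible_zero.mono fun φ z _ => ?_
    have h0 : ((0 : funModerate Ω) : A0 → ℂ → ℂ) φ = 0 := rfl
    rw [h0]
    simp
  smul_mem' u v hv := by
    intro K hK hKΩ n
    refine IsNegligible.mono (g := fun φ z => ∑ i ∈ Finset.range (n + 1), (n.choose i : ℝ) *
      (‖iteratedFDeriv ℝ i (u.1 φ) z‖ * ‖iteratedFDeriv ℝ (n - i) (v.1 φ) z‖)) ?_
      (fun φ z hz => norm_iteratedFDeriv_mul_le' (u.2.1 φ) (v.2.1 φ) (hKΩ hz) n)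
    refine isNegligible_sum _ _ fun i _ => ?_
    exact (isModerate_const _).mul_negligible
      ((u.2.2 K hK hKΩ i).mul_negligible (hv K hK hKΩ (n - i)) (fun _ _ => norm_nonneg _)
        fun _ _ => norm_nonneg _) (fun _ _ => Nat.cast_nonneg _) fun _ _ => by positivity

/-- The ring `𝒢(Ω)` of full generalized functions on `Ω`. -/
abbrev GenFun : Type := funModerate Ω ⧸ funNegligible Ω

/-- The class of a moderate family of functions. -/
abbrev GenFun.mk (u : funModerate Ω) : GenFun Ω := Ideal.Quotient.mk (funNegligible Ω) u

/-! ### The operators `∂/∂z` and `∂/∂z̄` -/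

/-- `∂g/∂z = (∂g/∂x - i ∂g/∂y)/2`. -/
noncomputable def dz (g : ℂ → ℂ) (z : ℂ) : ℂ :=
  (1 / 2) * (fderiv ℝ g z 1 - Complex.I * fderiv ℝ g z Complex.I)

/-- `∂g/∂z̄ = (∂g/∂x + i ∂g/∂y)/2`. -/
noncomputable def dbar (g : ℂ → ℂ) (z : ℂ) : ℂ :=
  (1 / 2) * (fderiv ℝ g z 1 + Complex.I * fderiv ℝ g z Complex.I)

/-- The linear form on differentials that gives `∂/∂z̄`. -/
noncomputable def dbarForm : (ℂ →L[ℝ] ℂ) →L[ℝ] ℂ :=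
  ((1 / 2 : ℂ) • (ContinuousLinearMap.apply ℝ ℂ (1 : ℂ) +
    Complex.I • ContinuousLinearMap.apply ℝ ℂ Complex.I))

theorem dbar_eq (g : ℂ → ℂ) : dbar g = dbarForm ∘ fderiv ℝ g := by
  funext z
  simp [dbar, dbarForm, mul_add]

variable {Ω}

theorem contDiffOn_dbar {g : ℂ → ℂ} (hg : ContDiffOn ℝ ∞ g Ω) : ContDiffOn ℝ ∞ (dbar g) Ω := by
  rw [dbar_eq]
  exact dbarForm.contDiff.comp_contDiffOn (hg.fderiv_of_isOpen Ω.isOpen (by simp))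

theorem norm_iteratedFDeriv_dbar_le {g : ℂ → ℂ} (hg : ContDiffOn ℝ ∞ g Ω) {z : ℂ} (hz : z ∈ Ω)
    (n : ℕ) :
    ‖iteratedFDeriv ℝ n (dbar g) z‖ ≤ ‖dbarForm‖ * ‖iteratedFDeriv ℝ (n + 1) g z‖ := by
  rw [dbar_eq, ← norm_iteratedFDeriv_fderiv]
  have h : ContDiffOn ℝ ∞ (fderiv ℝ g) Ω := hg.fderiv_of_isOpen Ω.isOpen (by simp)
  exact dbarForm.norm_iteratedFDeriv_comp_left (h.contDiffAt (Ω.isOpen.mem_nhds hz))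
    (by exact_mod_cast le_top)

theorem dbar_moderate {u : A0 → ℂ → ℂ} (hu : FunModerate Ω u) :
    FunModerate Ω (fun φ => dbar (u φ)) := by
  refine ⟨fun φ => contDiffOn_dbar (hu.1 φ), fun K hK hKΩ n => ?_⟩
  exact ((isModerate_const ‖dbarForm‖).mul (hu.2 K hK hKΩ (n + 1)) (fun _ _ => norm_nonneg dbarForm)
    fun _ _ => norm_nonneg _).mono
      fun φ z hz => norm_iteratedFDeriv_dbar_le (hu.1 φ) (hKΩ hz) n

theorem dbar_negligible {u : A0 → ℂ → ℂ} (hu : FunModerate Ω u) (h0 : FunNegligible Ω u) :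
    FunNegligible Ω (fun φ => dbar (u φ)) := by
  intro K hK hKΩ n
  exact ((isModerate_const ‖dbarForm‖).mul_negligible (h0 K hK hKΩ (n + 1))
    (fun _ _ => norm_nonneg dbarForm) fun _ _ => norm_nonneg _).mono
      fun φ z hz => norm_iteratedFDeriv_dbar_le (hu.1 φ) (hKΩ hz) n

/-- `∂/∂z̄` on representatives. -/
noncomputable def dbarRep (u : funModerate Ω) : funModerate Ω :=
  ⟨fun φ => dbar (u.1 φ), dbar_moderate u.2⟩

theorem dbarRep_sub (u v : funModerate Ω) :
    dbarRep u - dbarRep v - dbarRep (u - v) ∈ funNegligible Ω := by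
  intro K _ hKΩ n
  refine isNegligible_zero.mono fun φ z hz => ?_
  have key : ∀ w ∈ (Ω : Set ℂ), (dbarRep u - dbarRep v - dbarRep (u - v)).1 φ w = 0 := by
    intro w hw
    have h1 : DifferentiableAt ℝ (u.1 φ) w :=
      (contDiffAt_of_mem (u.2.1 φ) hw 1).differentiableAt (by simp)
    have h2 : DifferentiableAt ℝ (v.1 φ) w :=
      (contDiffAt_of_mem (v.2.1 φ) hw 1).differentiableAt (by simp)
    have h3 : fderiv ℝ ((u - v).1 φ) w = fderiv ℝ (u.1 φ) w - fderiv ℝ (v.1 φ) w :=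
      fderiv_sub h1 h2
    change dbar (u.1 φ) w - dbar (v.1 φ) w - dbar ((u - v).1 φ) w = 0
    simp only [dbar, h3, sub_apply]
    ring
  have hev : (dbarRep u - dbarRep v - dbarRep (u - v)).1 φ =ᶠ[𝓝 z] (fun _ => 0) :=
    Filter.eventuallyEq_of_mem (Ω.isOpen.mem_nhds (hKΩ hz)) key
  rw [(hev.iteratedFDeriv ℝ n).self_of_nhds]
  simp

/-- The operator `∂/∂z̄` on `𝒢(Ω)`. -/
noncomputable def GenFun.dbar (f : GenFun Ω) : GenFun Ω :=
  Quotient.liftOn' f (fun u => GenFun.mk Ω (dbarRep u)) (by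
    intro u v huv
    have huv' : u - v ∈ funNegligible Ω := (Submodule.quotientRel_def _).1 huv
    rw [Ideal.Quotient.mk_eq_mk_iff_sub_mem]
    have h : dbarRep (u - v) ∈ funNegligible Ω := dbar_negligible (u - v).2 huv'
    simpa using (funNegligible Ω).add_mem (dbarRep_sub u v) h)

/-- `f` belongs to `ℋ𝒢(Ω)`. -/
def GenFun.IsHolomorphic (f : GenFun Ω) : Prop := f.dbar = 0

/-! ### Compactly supported points and point values -/

variable (Ω)

/-- The moderate families of points of `Ω` with the compact support property. -/
def IsCompactlySupportedPt (x : A0 → ℂ) : Prop :=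
  NumModerate x ∧ (∀ φ, x φ ∈ Ω) ∧ ∃ K : Set ℂ, IsCompact K ∧ K ⊆ Ω ∧ ∃ p : ℕ, ∀ φ ∈ A p,
    ∃ η ∈ Set.Ioc (0 : ℝ) 1, ∀ ε ∈ Set.Ioo 0 η, x (φ.scale ε) ∈ K

/-- The set `Ω̃_c` of compactly supported generalized points of `Ω`. -/
def compactPts : Set GenNum :=
  {x | ∃ v : numModerate, GenNum.mk v = x ∧ IsCompactlySupportedPt Ω v.1}

variable {Ω}

theorem pointValue_moderate (u : funModerate Ω) {x : A0 → ℂ} (hx : IsCompactlySupportedPt Ω x) :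
    NumModerate (fun φ => u.1 φ (x φ)) := by
  obtain ⟨_, _, K, hK, hKΩ, p, hp⟩ := hx
  obtain ⟨N, hN⟩ := u.2.2 K hK hKΩ 0
  refine ⟨max N p, fun φ hφ => ?_⟩
  obtain ⟨c, hc, η, hη, H⟩ := hN φ (A_anti (le_max_left _ _) hφ)
  obtain ⟨θ, hθ, T⟩ := hp φ (A_anti (le_max_right _ _) hφ)
  refine ⟨c, hc, min η θ, ⟨lt_min hη.1 hθ.1, (min_le_left _ _).trans hη.2⟩, fun ε hε _ _ => ?_⟩
  have hε1 : ε ≤ 1 := (hε.2.trans_le ((min_le_left _ _).trans hη.2)).le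
  have h1 := H ε ⟨hε.1, hε.2.trans_le (min_le_left _ _)⟩ _
    (T ε ⟨hε.1, hε.2.trans_le (min_le_right _ _)⟩)
  beta_reduce at h1
  rw [norm_iteratedFDeriv_zero] at h1
  have a1 : (N : ℝ) ≤ ((max N p : ℕ) : ℝ) := by exact_mod_cast le_max_left N p
  exact h1.trans (mul_le_mul_of_nonneg_left
    (Real.rpow_le_rpow_of_exponent_ge hε.1 hε1 (by linarith)) hc.le)

/-- The generalized number `cl[(u_φ(x_φ))_φ]`. -/
def pointValue (u : funModerate Ω) (x : A0 → ℂ) (hx : IsCompactlySupportedPt Ω x) : GenNum :=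
  GenNum.mk ⟨fun φ => u.1 φ (x φ), pointValue_moderate u hx⟩

theorem pointValue_congr (u v : funModerate Ω) (x y : numModerate)
    (hx : IsCompactlySupportedPt Ω x.1) (hy : IsCompactlySupportedPt Ω y.1)
    (huv : GenFun.mk Ω u = GenFun.mk Ω v) (hxy : GenNum.mk x = GenNum.mk y) :
    pointValue u x.1 hx = pointValue v y.1 hy := by
  rw [Ideal.Quotient.mk_eq_mk_iff_sub_mem] at huv hxy
  trans pointValue u y.1 hy
  · unfold pointValue
    rw [Ideal.Quotient.mk_eq_mk_iff_sub_mem]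
    obtain ⟨_, _, K, hK, hKΩ, p, hp⟩ := hx
    obtain ⟨δ, hδ, hδΩ⟩ := hK.exists_cthickening_subset_open Ω.isOpen hKΩ
    obtain ⟨N, hN⟩ := u.2.2 _ hK.cthickening hδΩ 1
    obtain ⟨M, γ, hγ, hM⟩ := hxy
    obtain ⟨q₀, hq₀⟩ := Filter.eventually_atTop.1 (hγ.2.2.eventually_ge_atTop ((M : ℝ) + 1))
    refine ⟨N + M + p + q₀, γ, hγ, fun q hq φ hφ => ?_⟩
    obtain ⟨c, hc, η, hη, H⟩ := hN φ (A_anti (by omega) hφ)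
    obtain ⟨d, hd, θ, hθ, T⟩ := hM q (by omega) φ hφ
    obtain ⟨κ, hκ, P⟩ := hp φ (A_anti (by omega) hφ)
    refine ⟨c * d, by positivity, min (min η θ) (min κ (δ / d)), ⟨?_, ?_⟩, fun ε hε _ _ => ?_⟩
    · have : 0 < δ / d := by positivity
      simp only [lt_min_iff]
      exact ⟨⟨hη.1, hθ.1⟩, hκ.1, this⟩
    · exact (min_le_left _ _).trans ((min_le_left _ _).trans hη.2)
    have hε0 := hε.1
    have hε' := hε.2
    simp only [lt_min_iff] at hε'
    obtain ⟨⟨e1, e2⟩, e3, e4⟩ := hε'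
    have hε1 : ε ≤ 1 := (e1.trans_le hη.2).le
    have hxK := P ε ⟨hε0, e3⟩
    have hd1 : ‖x.1 (φ.scale ε) - y.1 (φ.scale ε)‖ ≤ d * ε ^ (γ q - (M : ℝ)) :=
      T ε ⟨hε0, e2⟩ () trivial
    have hγq : (M : ℝ) + 1 ≤ γ q := hq₀ q (by omega)
    have hd2 : ‖x.1 (φ.scale ε) - y.1 (φ.scale ε)‖ ≤ δ := by
      refine hd1.trans ?_
      have : ε ^ (γ q - (M : ℝ)) ≤ ε ^ (1 : ℝ) :=
        Real.rpow_le_rpow_of_exponent_ge hε0 hε1 (by linarith)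
      rw [Real.rpow_one] at this
      calc d * ε ^ (γ q - (M : ℝ)) ≤ d * (δ / d) :=
            mul_le_mul_of_nonneg_left (this.trans e4.le) hd.le
        _ = δ := by field_simp
    have hball : Metric.closedBall (x.1 (φ.scale ε)) δ ⊆ Metric.cthickening δ K :=
      Metric.closedBall_subset_cthickening hxK δ
    have hmv := (convex_closedBall (x.1 (φ.scale ε)) δ).norm_image_sub_le_of_norm_fderiv_le
      (𝕜 := ℝ) (f := u.1 (φ.scale ε)) (C := c * ε ^ (-(N : ℝ)))
      (x := y.1 (φ.scale ε)) (y := x.1 (φ.scale ε))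
      (fun w hw => (contDiffAt_of_mem (u.2.1 _) (hδΩ (hball hw)) 1).differentiableAt (by simp))
      (fun w hw => by
        rw [← norm_iteratedFDeriv_one]
        exact H ε ⟨hε0, e1⟩ w (hball hw))
      (by rw [Metric.mem_closedBall, dist_comm, dist_eq_norm]; exact hd2)
      (Metric.mem_closedBall_self hδ.le)
    have hpos : 0 ≤ c * ε ^ (-(N : ℝ)) := mul_nonneg hc.le (Real.rpow_nonneg hε0.le _)
    refine (hmv.trans (mul_le_mul_of_nonneg_left hd1 hpos)).trans ?_
    have e : c * ε ^ (-(N : ℝ)) * (d * ε ^ (γ q - (M : ℝ))) =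
        c * d * ε ^ (-(N : ℝ) + (γ q - (M : ℝ))) := by
      rw [Real.rpow_add hε0]
      ring
    rw [e]
    refine mul_le_mul_of_nonneg_left ?_ (by positivity)
    refine Real.rpow_le_rpow_of_exponent_ge hε0 hε1 ?_
    push_cast
    have h1 : (0 : ℝ) ≤ (p : ℝ) := p.cast_nonneg
    have h2 : (0 : ℝ) ≤ (q₀ : ℝ) := q₀.cast_nonneg
    linarith
  · unfold pointValue
    rw [Ideal.Quotient.mk_eq_mk_iff_sub_mem]
    obtain ⟨_, _, K, hK, hKΩ, p, hp⟩ := hy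
    obtain ⟨M, γ, hγ, hM⟩ := huv K hK hKΩ 0
    refine ⟨M + p, γ, hγ, fun q hq φ hφ => ?_⟩
    obtain ⟨d, hd, θ, hθ, T⟩ := hM q (by omega) φ hφ
    obtain ⟨κ, hκ, P⟩ := hp φ (A_anti (by omega) hφ)
    refine ⟨d, hd, min θ κ, ⟨lt_min hθ.1 hκ.1, (min_le_left _ _).trans hθ.2⟩, fun ε hε _ _ => ?_⟩
    have hε1 : ε ≤ 1 := (hε.2.trans_le ((min_le_left _ _).trans hθ.2)).le
    have h1 := T ε ⟨hε.1, hε.2.trans_le (min_le_left _ _)⟩ _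
      (P ε ⟨hε.1, hε.2.trans_le (min_le_right _ _)⟩)
    beta_reduce at h1
    rw [norm_iteratedFDeriv_zero] at h1
    refine h1.trans (mul_le_mul_of_nonneg_left ?_ hd.le)
    refine Real.rpow_le_rpow_of_exponent_ge hε.1 hε1 ?_
    push_cast
    have h1 : (0 : ℝ) ≤ (p : ℝ) := p.cast_nonneg
    linarith

/-- `κ(f) : Ω̃_c → GenNum`, `κ(f)(x) = cl[(u_φ(x_φ))_φ]` for representatives `u` of `f` and `x_φ`
of `x`. The definition picks representatives; `kappa_mk` says that any others give the same. -/
noncomputable def kappa (f : GenFun Ω) (x : compactPts Ω) : GenNum :=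
  pointValue (Ideal.Quotient.mk_surjective f).choose x.2.choose.1 x.2.choose_spec.2

theorem kappa_mk (u : funModerate Ω) (v : numModerate) (hv : IsCompactlySupportedPt Ω v.1) :
    kappa (GenFun.mk Ω u) ⟨GenNum.mk v, v, rfl, hv⟩ = pointValue u v.1 hv := by
  have hx : GenNum.mk v ∈ compactPts Ω := ⟨v, rfl, hv⟩
  exact pointValue_congr _ u hx.choose v hx.choose_spec.2 hv
    (Ideal.Quotient.mk_surjective (GenFun.mk Ω u)).choose_spec hx.choose_spec.1

/-! ### Sub-linear generalized functions -/

/-- `f` is sub-linear: for some representative `u` of `f` and each point of `Ω̃_c` there are a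
representative `(x_φ)` of the point, a real `k`, reals `p_n` with `p_n + k n → ∞` and naturals `N_n`
such that, for all `n` and all `φ ∈ 𝒜_{N_n}`, one has `|∂_z^n u(φ_ε, x(φ_ε))| ≤ C ε^(p_n)` for all
small `ε`. As in the other estimates, `C` and the bound on `ε` may depend on `φ` (and on `n`). -/
def GenFun.IsSublinear (f : GenFun Ω) : Prop :=
  ∃ u : funModerate Ω, GenFun.mk Ω u = f ∧ ∀ x ∈ compactPts Ω,
    ∃ v : numModerate, GenNum.mk v = x ∧ IsCompactlySupportedPt Ω v.1 ∧
      ∃ k : ℝ, ∃ p : ℕ → ℝ, ∃ N : ℕ → ℕ,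
        Filter.Tendsto (fun n : ℕ => p n + k * (n : ℝ)) Filter.atTop Filter.atTop ∧
        ∀ n : ℕ, ∀ φ ∈ A (N n), ∃ C : ℝ, 0 < C ∧ ∃ η ∈ Set.Ioc (0 : ℝ) 1, ∀ ε ∈ Set.Ioo 0 η,
          ‖(dz^[n] (u.1 (φ.scale ε))) (v.1 (φ.scale ε))‖ ≤ C * ε ^ (p n)

end functions

end Colombeau

/-!
The equivalence holds because both sides hold for every `f ∈ ℋ𝒢(Ω)`: the Cauchy estimates make `f`
sub-linear with `k = 1`, and the same estimates make its Taylor series converge to `κ(f)`.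

Let `u` represent `f`. By negligibility, `∂u_{φ_ε}/∂z̄` and its derivatives are `O(ε^B)` on compact
sets, for any prescribed `B`, once `φ ∈ 𝒜_N` with `N` large. For a smooth function `g` such that
`|∂g/∂z̄| ≤ δ` and `|∂²g/∂z∂z̄| ≤ δ`, integration over circles gives the Cauchy estimate
`|∂g/∂z (x)| ≤ M/r + (1 + 2r) δ`, where `M` bounds `|g|` on the disc of radius `r` about `x`
(`norm_dz_le`). Applied `n` times, to functions for which `∂/∂z̄` of `∂ʲg/∂zʲ` is at most `δ` for
`j ≤ n`, it bounds `∂ⁿg/∂zⁿ` by a constant times `M + δ` (`norm_iterate_dz_le_of_closedBall`). Thus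
if `u_{φ_ε} = O(ε^(-L))` on a compact neighbourhood of `K`, then `∂ⁿu_{φ_ε}/∂zⁿ = O(ε^(-L))` on `K`
for all `n`, with the same `L` (`exists_uniform_exponent`). This is sub-linearity with `p_n = -L`
and `k = 1`.

For analyticity at a point `z₀` the ball of radius `R = 1` suffices: `‖z - z₀‖ < 1` means that
`z - z₀ = O(ε^r)` for some `r > 0`, so `z` has a representative that stays near the support of the
one of `z₀` (`exists_rep_near`). By Taylor's formula with small `∂/∂z̄` (`norm_sub_taylor_le`), the
remainder of order `m` is `O(ε^(rm - L)) + O(ε^B)` for every `B`, and `rm - L → ∞`; so the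
remainders tend to zero in the sharp topology.
-/

namespace Colombeau

/-! ### The operators `∂/∂z` and `∂/∂z̄` on smooth functions -/

/-- The differential as `dg = ∂g/∂z dz + ∂g/∂z̄ dz̄`. -/
theorem fderiv_apply_eq_dz_dbar (g : ℂ → ℂ) (w h : ℂ) :
    fderiv ℝ g w h = dz g w * h + dbar g w * (starRingEnd ℂ) h := by
  have hh : h = h.re • (1 : ℂ) + h.im • Complex.I := by
    simp [Complex.re_add_im]
  have h1 : fderiv ℝ g w h = h.re * fderiv ℝ g w 1 + h.im * fderiv ℝ g w Complex.I := by
    conv_lhs => rw [hh]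
    rw [map_add, map_smul, map_smul, Complex.real_smul, Complex.real_smul]
  have h2 : h = h.re + h.im * Complex.I := (Complex.re_add_im h).symm
  have h3 : (starRingEnd ℂ) h = h.re - h.im * Complex.I := by
    apply Complex.ext <;> simp
  rw [h1, h3]
  conv_rhs => rw [h2]
  simp only [Complex.add_re, Complex.ofReal_re, Complex.mul_re, Complex.I_re, mul_zero,
    Complex.ofReal_im, Complex.I_im, mul_one, sub_self, add_zero, Complex.add_im, Complex.mul_im,
    zero_add, dz, dbar]
  linear_combination (h.im * fderiv ℝ g w Complex.I) * Complex.I_mul_I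

/-- The linear form on differentials that gives `∂/∂z`. -/
noncomputable def dzForm : (ℂ →L[ℝ] ℂ) →L[ℝ] ℂ :=
  ((1 / 2 : ℂ) • (ContinuousLinearMap.apply ℝ ℂ (1 : ℂ) -
    Complex.I • ContinuousLinearMap.apply ℝ ℂ Complex.I))

theorem dz_eq (g : ℂ → ℂ) : dz g = dzForm ∘ fderiv ℝ g := by
  funext z
  simp [dz, dzForm, mul_sub]

section open_set

variable {Ω : TopologicalSpace.Opens ℂ}

theorem contDiffOn_dz {g : ℂ → ℂ} (hg : ContDiffOn ℝ ∞ g Ω) : ContDiffOn ℝ ∞ (dz g) Ω := by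
  rw [dz_eq]
  exact dzForm.contDiff.comp_contDiffOn (hg.fderiv_of_isOpen Ω.isOpen (by simp))

theorem contDiffOn_iterate_dz {g : ℂ → ℂ} (hg : ContDiffOn ℝ ∞ g Ω) (n : ℕ) :
    ContDiffOn ℝ ∞ (dz^[n] g) Ω := by
  induction n with
  | zero => exact hg
  | succ n ih =>
    rw [Function.iterate_succ_apply']
    exact contDiffOn_dz ih

theorem norm_iteratedFDeriv_dz_le {g : ℂ → ℂ} (hg : ContDiffOn ℝ ∞ g Ω) {z : ℂ} (hz : z ∈ Ω)
    (n : ℕ) :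
    ‖iteratedFDeriv ℝ n (dz g) z‖ ≤ ‖dzForm‖ * ‖iteratedFDeriv ℝ (n + 1) g z‖ := by
  rw [dz_eq, ← norm_iteratedFDeriv_fderiv]
  have h : ContDiffOn ℝ ∞ (fderiv ℝ g) Ω := hg.fderiv_of_isOpen Ω.isOpen (by simp)
  exact dzForm.norm_iteratedFDeriv_comp_left (h.contDiffAt (Ω.isOpen.mem_nhds hz))
    (by exact_mod_cast le_top)

theorem norm_iterate_dz_le {g : ℂ → ℂ} (hg : ContDiffOn ℝ ∞ g Ω) {z : ℂ} (hz : z ∈ Ω) (n : ℕ) :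
    ‖(dz^[n] g) z‖ ≤ ‖dzForm‖ ^ n * ‖iteratedFDeriv ℝ n g z‖ := by
  -- The induction on `n` needs the real derivatives of all orders `k` of `∂ⁿg/∂zⁿ`.
  have key : ∀ n k, ‖iteratedFDeriv ℝ k (dz^[n] g) z‖ ≤
      ‖dzForm‖ ^ n * ‖iteratedFDeriv ℝ (k + n) g z‖ := by
    intro n
    induction n with
    | zero => simp
    | succ n ih =>
      intro k
      rw [Function.iterate_succ_apply']
      refine (norm_iteratedFDeriv_dz_le (contDiffOn_iterate_dz hg n) hz k).trans ?_
      refine (mul_le_mul_of_nonneg_left (ih (k + 1)) (norm_nonneg dzForm)).trans (le_of_eq ?_)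
      rw [show k + 1 + n = k + (n + 1) by ring]
      ring
  have h := key n 0
  rwa [norm_iteratedFDeriv_zero, Nat.zero_add] at h

theorem dbar_congr {g h : ℂ → ℂ} (hgh : Set.EqOn g h Ω) : Set.EqOn (dbar g) (dbar h) Ω := by
  intro z hz
  simp only [dbar, (Filter.eventuallyEq_of_mem (Ω.isOpen.mem_nhds hz) hgh).fderiv_eq]

theorem dz_congr {g h : ℂ → ℂ} (hgh : Set.EqOn g h Ω) : Set.EqOn (dz g) (dz h) Ω := by
  intro z hz
  simp only [dz, (Filter.eventuallyEq_of_mem (Ω.isOpen.mem_nhds hz) hgh).fderiv_eq]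

theorem dbar_dz_eqOn {g : ℂ → ℂ} (hg : ContDiffOn ℝ ∞ g Ω) :
    Set.EqOn (dbar (dz g)) (dz (dbar g)) Ω := by
  intro z hz
  have hd : DifferentiableAt ℝ (fderiv ℝ g) z :=
    ((hg.fderiv_of_isOpen (m := ∞) Ω.isOpen (by simp)).contDiffAt
      (Ω.isOpen.mem_nhds hz)).differentiableAt (by simp)
  have h1 : fderiv ℝ (dz g) z = dzForm.comp (fderiv ℝ (fderiv ℝ g) z) := by
    rw [dz_eq]
    exact (dzForm.hasFDerivAt.comp z hd.hasFDerivAt).fderiv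
  have h2 : fderiv ℝ (dbar g) z = dbarForm.comp (fderiv ℝ (fderiv ℝ g) z) := by
    rw [dbar_eq]
    exact (dbarForm.hasFDerivAt.comp z hd.hasFDerivAt).fderiv
  have hs : IsSymmSndFDerivAt ℝ g z :=
    (contDiffAt_of_mem hg hz 2).isSymmSndFDerivAt (by simp)
  have hs' := hs.eq 1 Complex.I
  simp only [dbar, dz] at *
  rw [h1, h2]
  simp only [ContinuousLinearMap.comp_apply, dzForm, dbarForm, smul_apply, add_apply, sub_apply,
    ContinuousLinearMap.apply_apply, smul_eq_mul, hs']
  ring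

theorem dbar_iterate_dz_eqOn {g : ℂ → ℂ} (hg : ContDiffOn ℝ ∞ g Ω) (n : ℕ) :
    Set.EqOn (dbar (dz^[n] g)) (dz^[n] (dbar g)) Ω := by
  induction n with
  | zero => exact fun _ _ => rfl
  | succ n ih =>
    rw [Function.iterate_succ_apply', Function.iterate_succ_apply']
    exact (dbar_dz_eqOn (contDiffOn_iterate_dz hg n)).trans (dz_congr ih)

end open_set

/-! ### Circle integrals and the Cauchy estimate on the plane -/

theorem hasDerivAt_intervalIntegral_of_continuous {F F' : ℝ → ℝ → ℂ} (a b : ℝ)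
    (hF : Continuous fun p : ℝ × ℝ => F p.1 p.2) (hF' : Continuous fun p : ℝ × ℝ => F' p.1 p.2)
    (hd : ∀ x t, HasDerivAt (fun y => F y t) (F' x t) x) (x : ℝ) :
    HasDerivAt (fun y => ∫ t in a..b, F y t) (∫ t in a..b, F' x t) x := by
  obtain ⟨C, hC⟩ := ((isCompact_closedBall x 1).prod (isCompact_uIcc (a := a) (b := b))
    ).exists_bound_of_continuousOn hF'.continuousOn
  have c1 : ∀ y, Continuous (F y) := fun y => hF.comp (Continuous.prodMk_right y)
  have c2 : ∀ y, Continuous (F' y) := fun y => hF'.comp (Continuous.prodMk_right y)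
  refine (intervalIntegral.hasDerivAt_integral_of_dominated_loc_of_deriv_le
    (bound := fun _ => C) (Metric.closedBall_mem_nhds x one_pos)
    (Filter.Eventually.of_forall fun y => (c1 y).aestronglyMeasurable)
    ((c1 x).intervalIntegrable _ _) (c2 x).aestronglyMeasurable ?_ (by simp) ?_).2
  · exact Filter.Eventually.of_forall fun t ht y hy =>
      hC (y, t) ⟨hy, Set.uIoc_subset_uIcc ht⟩
  · exact Filter.Eventually.of_forall fun t _ y _ => hd y t

open Complex in
theorem integral_exp_ofReal_mul_I : ∫ θ in (0 : ℝ)..2 * Real.pi, exp (θ * I) = 0 := by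
  have := integral_exp_mul_complex (a := 0) (b := 2 * Real.pi) I_ne_zero
  simp only [mul_comm I] at this
  rw [this]
  simp

open Complex in
theorem conj_exp_ofReal_mul_I (θ : ℝ) :
    (starRingEnd ℂ) (exp (θ * I)) = exp (-(θ * I)) := by
  rw [← exp_conj]
  simp

open Complex in
theorem integral_exp_neg_ofReal_mul_I : ∫ θ in (0 : ℝ)..2 * Real.pi, exp (-(θ * I)) = 0 := by
  have := integral_exp_mul_complex (a := 0) (b := 2 * Real.pi) (neg_ne_zero.2 I_ne_zero)
  simp only [mul_comm (-I), mul_neg] at this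
  rw [this]
  simp [exp_neg]

theorem continuous_fderiv_circleMap {g : ℂ → ℂ} (hg : ContDiff ℝ ∞ g) (x : ℂ) :
    Continuous fun p : ℝ × ℝ => fderiv ℝ g (circleMap x p.1 p.2) := by
  have h : Continuous fun p : ℝ × ℝ => circleMap x p.1 p.2 := by
    unfold circleMap
    fun_prop
  exact (hg.continuous_fderiv (by simp)).comp h

open Complex in
theorem hasDerivAt_comp_circleMap_radius {g : ℂ → ℂ} (hg : ContDiff ℝ ∞ g) (x : ℂ) (ρ θ : ℝ) :
    HasDerivAt (fun y : ℝ => g (circleMap x y θ))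
      (fderiv ℝ g (circleMap x ρ θ) (exp (θ * I))) ρ := by
  have h1 : HasDerivAt (fun y : ℝ => circleMap x y θ) (exp (θ * I)) ρ := by
    unfold circleMap
    simpa using ((hasDerivAt_id ρ).ofReal_comp.mul_const (exp (θ * I))).const_add x
  exact (hg.differentiable (by simp) _).hasFDerivAt.comp_hasDerivAt ρ h1

open Complex in
/-- The angular derivative of `g` integrates to zero along a circle. -/
theorem integral_dz_sub_dbar_circleMap {g : ℂ → ℂ} (hg : ContDiff ℝ ∞ g) (x : ℂ) (ρ : ℝ) :
    ∫ θ in (0 : ℝ)..2 * Real.pi, (dz g (circleMap x ρ θ) * exp (θ * I) -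
      dbar g (circleMap x ρ θ) * exp (-(θ * I))) = 0 := by
  rcases eq_or_ne ρ 0 with rfl | hρ
  · simp only [circleMap_zero_radius, Function.const_apply]
    rw [intervalIntegral.integral_sub, intervalIntegral.integral_const_mul,
      intervalIntegral.integral_const_mul, integral_exp_ofReal_mul_I,
      integral_exp_neg_ofReal_mul_I]
    · simp
    all_goals exact Continuous.intervalIntegrable (by fun_prop) _ _
  · have hd : ∀ θ : ℝ, HasDerivAt (fun t : ℝ => g (circleMap x ρ t))
        (fderiv ℝ g (circleMap x ρ θ) (circleMap 0 ρ θ * I)) θ := fun θ =>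
      (hg.differentiable (by simp) _).hasFDerivAt.comp_hasDerivAt θ (hasDerivAt_circleMap x ρ θ)
    have hc : Continuous fun θ : ℝ => fderiv ℝ g (circleMap x ρ θ) (circleMap 0 ρ θ * I) :=
      ((hg.continuous_fderiv (by simp)).comp (continuous_circleMap x ρ)).clm_apply
        ((continuous_circleMap 0 ρ).mul continuous_const)
    have h := intervalIntegral.integral_eq_sub_of_hasDerivAt (a := 0) (b := 2 * Real.pi)
      (fun θ _ => hd θ) (hc.intervalIntegrable _ _)
    have e : ∀ θ : ℝ, fderiv ℝ g (circleMap x ρ θ) (circleMap 0 ρ θ * I) = (ρ * I) *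
        (dz g (circleMap x ρ θ) * exp (θ * I) - dbar g (circleMap x ρ θ) * exp (-(θ * I))) := by
      intro θ
      rw [fderiv_apply_eq_dz_dbar]
      simp only [circleMap, zero_add, map_mul, conj_ofReal, conj_exp_ofReal_mul_I, conj_I]
      ring
    have h0 : circleMap x ρ (2 * Real.pi) = circleMap x ρ 0 := by
      simpa using periodic_circleMap x ρ 0
    simp only [e, intervalIntegral.integral_const_mul, h0, sub_self] at h
    exact (mul_eq_zero.1 h).resolve_left (mul_ne_zero (by exact_mod_cast hρ) I_ne_zero)

open Complex in
/-- The mean value property, up to an error controlled by `∂g/∂z̄`. -/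
theorem norm_circle_mean_sub_le {g : ℂ → ℂ} (hg : ContDiff ℝ ∞ g) (x : ℂ) {r δ : ℝ} (hr : 0 ≤ r)
    (hδ : ∀ w ∈ Metric.closedBall x r, ‖dbar g w‖ ≤ δ) :
    ‖(∫ θ in (0 : ℝ)..2 * Real.pi, g (circleMap x r θ)) - 2 * Real.pi * g x‖ ≤
      4 * Real.pi * δ * r := by
  have hc : Continuous fun p : ℝ × ℝ => circleMap x p.1 p.2 := by
    unfold circleMap
    fun_prop
  have hder := hasDerivAt_intervalIntegral_of_continuous 0 (2 * Real.pi)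
    (F := fun ρ θ => g (circleMap x ρ θ))
    (F' := fun ρ θ => fderiv ℝ g (circleMap x ρ θ) (exp (θ * I)))
    (hg.continuous.comp hc) ((continuous_fderiv_circleMap hg x).clm_apply (by fun_prop))
    (hasDerivAt_comp_circleMap_radius hg x)
  have hdz : Continuous (dz g) := by
    rw [dz_eq]; exact dzForm.continuous.comp (hg.continuous_fderiv (by simp))
  have hdb : Continuous (dbar g) := by
    rw [dbar_eq]; exact dbarForm.continuous.comp (hg.continuous_fderiv (by simp))
  have hb : ∀ ρ ∈ Set.Ico 0 r, ‖∫ θ in (0 : ℝ)..2 * Real.pi,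
      fderiv ℝ g (circleMap x ρ θ) (exp (θ * I))‖ ≤ 4 * Real.pi * δ := by
    intro ρ hρ
    have e : ∀ θ : ℝ, fderiv ℝ g (circleMap x ρ θ) (exp (θ * I)) =
        (dz g (circleMap x ρ θ) * exp (θ * I) - dbar g (circleMap x ρ θ) * exp (-(θ * I))) +
          2 * dbar g (circleMap x ρ θ) * exp (-(θ * I)) := by
      intro θ
      rw [fderiv_apply_eq_dz_dbar, conj_exp_ofReal_mul_I]
      ring
    have cm := continuous_circleMap x ρ
    have c1 := hdz.comp cm
    have c2 := hdb.comp cm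
    simp only [Function.comp_def] at c1 c2
    simp only [e]
    rw [intervalIntegral.integral_add, integral_dz_sub_dbar_circleMap hg, zero_add]
    · refine (intervalIntegral.norm_integral_le_of_norm_le_const (C := 2 * δ) fun θ _ => ?_).trans
        (le_of_eq ?_)
      · have hw := hδ (circleMap x ρ θ) (Metric.closedBall_subset_closedBall hρ.2.le
          (circleMap_mem_closedBall x hρ.1 θ))
        have : ‖exp (-(θ * I))‖ = 1 := by
          rw [← neg_mul, ← ofReal_neg, norm_exp_ofReal_mul_I]
        rw [norm_mul, norm_mul, this, mul_one, Complex.norm_two]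
        linarith
      · rw [sub_zero, abs_of_pos Real.two_pi_pos]
        ring
    all_goals exact Continuous.intervalIntegrable (by fun_prop) _ _
  have := norm_image_sub_le_of_norm_deriv_le_segment' (a := 0) (b := r)
    (fun ρ _ => (hder ρ).hasDerivWithinAt) hb r ⟨hr, le_rfl⟩
  simpa [mul_comm, mul_assoc, mul_left_comm] using this

open Complex in
/-- A Cauchy estimate for `∂g/∂z`, with an error controlled by `∂g/∂z̄`. The integral of
`e^(-iθ) g(x + ρ e^(iθ))` over the circle vanishes at `ρ = 0`, and its derivative in `ρ` is close to
the integral of `∂g/∂z`, hence to `2π ∂g/∂z (x)`. -/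
theorem norm_dz_le_of_contDiff {g : ℂ → ℂ} (hg : ContDiff ℝ ∞ g) (x : ℂ) {r δ M : ℝ} (hr : 0 < r)
    (hM : ∀ w ∈ Metric.closedBall x r, ‖g w‖ ≤ M)
    (hδ : ∀ w ∈ Metric.closedBall x r, ‖dbar g w‖ ≤ δ)
    (hδ' : ∀ w ∈ Metric.closedBall x r, ‖dbar (dz g) w‖ ≤ δ) :
    ‖dz g x‖ ≤ M / r + (1 + 2 * r) * δ := by
  have hc : Continuous fun p : ℝ × ℝ => circleMap x p.1 p.2 := by
    unfold circleMap
    fun_prop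
  have hdzs : ContDiff ℝ ∞ (dz g) := by
    rw [dz_eq]; exact dzForm.contDiff.comp (hg.fderiv_right (by simp))
  have hdz := hdzs.continuous
  have hdb : Continuous (dbar g) := by
    rw [dbar_eq]; exact dbarForm.continuous.comp (hg.continuous_fderiv (by simp))
  have hn : ∀ θ : ℝ, ‖exp (-(θ * I))‖ = 1 := fun θ => by
    rw [← neg_mul, ← ofReal_neg, norm_exp_ofReal_mul_I]
  have hpi := Real.pi_pos
  have hder := hasDerivAt_intervalIntegral_of_continuous 0 (2 * Real.pi)
    (F := fun ρ θ => g (circleMap x ρ θ) * exp (-(θ * I)))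
    (F' := fun ρ θ => fderiv ℝ g (circleMap x ρ θ) (exp (θ * I)) * exp (-(θ * I)))
    ((hg.continuous.comp hc).mul (by fun_prop))
    (((continuous_fderiv_circleMap hg x).clm_apply (by fun_prop)).mul (by fun_prop))
    (fun ρ θ => (hasDerivAt_comp_circleMap_radius hg x ρ θ).mul_const _)
  have hder' := fun ρ : ℝ => (hder ρ).sub ((hasDerivAt_id ρ).ofReal_comp.mul_const
    (2 * Real.pi * dz g x))
  have hb : ∀ ρ ∈ Set.Ico 0 r, ‖(∫ θ in (0 : ℝ)..2 * Real.pi,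
      fderiv ℝ g (circleMap x ρ θ) (exp (θ * I)) * exp (-(θ * I))) -
        ((1 : ℝ) : ℂ) * (2 * Real.pi * dz g x)‖ ≤ 2 * Real.pi * ((1 + 2 * r) * δ) := by
    intro ρ hρ
    have e : ∀ θ : ℝ, fderiv ℝ g (circleMap x ρ θ) (exp (θ * I)) * exp (-(θ * I)) =
        dz g (circleMap x ρ θ) +
          dbar g (circleMap x ρ θ) * exp (-(θ * I)) * exp (-(θ * I)) := by
      intro θ
      rw [fderiv_apply_eq_dz_dbar, conj_exp_ofReal_mul_I, add_mul, mul_assoc, ← exp_add]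
      simp
    have cm := continuous_circleMap x ρ
    have c1 := hdz.comp cm
    have c2 := hdb.comp cm
    simp only [Function.comp_def] at c1 c2
    simp only [e]
    have hsub : Metric.closedBall x ρ ⊆ Metric.closedBall x r :=
      Metric.closedBall_subset_closedBall hρ.2.le
    have hδ0 : 0 ≤ δ := (norm_nonneg _).trans (hδ x (Metric.mem_closedBall_self hr.le))
    have h1 := norm_circle_mean_sub_le hdzs x hρ.1 (fun w hw => hδ' w (hsub hw))
    have h2 : ‖∫ θ in (0 : ℝ)..2 * Real.pi,
        dbar g (circleMap x ρ θ) * exp (-(θ * I)) * exp (-(θ * I))‖ ≤ δ * (2 * Real.pi) := by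
      refine (intervalIntegral.norm_integral_le_of_norm_le_const (C := δ) fun θ _ => ?_).trans
        (le_of_eq ?_)
      · have hw := hδ (circleMap x ρ θ) (hsub (circleMap_mem_closedBall x hρ.1 θ))
        rwa [norm_mul, norm_mul, hn, mul_one, mul_one]
      · rw [sub_zero, abs_of_pos Real.two_pi_pos]
    rw [intervalIntegral.integral_add, ofReal_one, one_mul, add_sub_right_comm]
    · refine (norm_add_le _ _).trans ((add_le_add h1 h2).trans ?_)
      have : 4 * Real.pi * δ * ρ ≤ 4 * Real.pi * δ * r :=
        mul_le_mul_of_nonneg_left hρ.2.le (by positivity)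
      linarith
    all_goals exact Continuous.intervalIntegrable (by fun_prop) _ _
  have h3 := norm_image_sub_le_of_norm_deriv_le_segment' (a := 0) (b := r)
    (fun ρ _ => (hder' ρ).hasDerivWithinAt) hb r ⟨hr.le, le_rfl⟩
  have h4 : ‖∫ θ in (0 : ℝ)..2 * Real.pi, g (circleMap x r θ) * exp (-(θ * I))‖ ≤
      M * (2 * Real.pi) := by
    refine (intervalIntegral.norm_integral_le_of_norm_le_const (C := M) fun θ _ => ?_).trans
      (le_of_eq ?_)
    · rw [norm_mul, hn, mul_one]
      exact hM _ (circleMap_mem_closedBall x hr.le θ)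
    · rw [sub_zero, abs_of_pos Real.two_pi_pos]
  have h5 : ∫ θ in (0 : ℝ)..2 * Real.pi, g (circleMap x 0 θ) * exp (-(θ * I)) = 0 := by
    simp only [circleMap_zero_radius, Function.const_apply]
    rw [intervalIntegral.integral_const_mul, integral_exp_neg_ofReal_mul_I, mul_zero]
  simp only [Pi.sub_apply, h5, id, ofReal_zero, zero_mul, sub_zero] at h3
  have h6 : ‖(r : ℂ) * (2 * Real.pi * dz g x)‖ = r * (2 * Real.pi) * ‖dz g x‖ := by
    simp [abs_of_pos hr, abs_of_pos hpi, mul_assoc]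
  have h7 := norm_le_norm_add_norm_sub' ((r : ℂ) * (2 * Real.pi * dz g x))
    (∫ θ in (0 : ℝ)..2 * Real.pi, g (circleMap x r θ) * exp (-(θ * I)))
  rw [norm_sub_rev, h6] at h7
  have h8 : r * (2 * Real.pi) * ‖dz g x‖ ≤
      (r * (2 * Real.pi)) * (M / r + (1 + 2 * r) * δ) := by
    refine (h7.trans (add_le_add h4 h3)).trans (le_of_eq ?_)
    field_simp
  exact le_of_mul_le_mul_left h8 (by positivity)

/-! ### Cauchy estimates and Taylor's formula on an open set -/

section open_set

variable {Ω : TopologicalSpace.Opens ℂ}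

/-- The Cauchy estimate for functions that are smooth on an open set only. A smooth cutoff that is
`1` near the closed disc reduces it to functions that are smooth on `ℂ`. -/
theorem norm_dz_le {g : ℂ → ℂ} (hg : ContDiffOn ℝ ∞ g Ω) (x : ℂ) {r δ M : ℝ} (hr : 0 < r)
    (hΩ : Metric.closedBall x r ⊆ Ω)
    (hM : ∀ w ∈ Metric.closedBall x r, ‖g w‖ ≤ M)
    (hδ : ∀ w ∈ Metric.closedBall x r, ‖dbar g w‖ ≤ δ)
    (hδ' : ∀ w ∈ Metric.closedBall x r, ‖dbar (dz g) w‖ ≤ δ) :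
    ‖dz g x‖ ≤ M / r + (1 + 2 * r) * δ := by
  obtain ⟨s, hs, hsΩ⟩ := (isCompact_closedBall x r).exists_cthickening_subset_open Ω.isOpen hΩ
  rw [cthickening_closedBall hs.le hr.le] at hsΩ
  let b : ContDiffBump x := ⟨r + s / 2, s + r, by positivity, by linarith⟩
  let g' : ℂ → ℂ := fun z => b z • g z
  have hg' : ContDiff ℝ ∞ g' := by
    rw [contDiff_iff_contDiffAt]
    intro z
    by_cases hz : z ∈ Metric.closedBall x (s + r)
    · exact b.contDiffAt.smul (hg.contDiffAt (Ω.isOpen.mem_nhds (hsΩ hz)))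
    · have : g' =ᶠ[𝓝 z] fun _ => 0 := by
        filter_upwards [Metric.isClosed_closedBall.isOpen_compl.mem_nhds hz] with w hw
        have h1 : b w = 0 := b.zero_of_le_dist (by
          have : ¬ dist w x ≤ s + r := hw
          exact (not_le.1 this).le)
        simp only [g', h1, zero_smul]
      exact contDiffAt_const.congr_of_eventuallyEq this
  let U : TopologicalSpace.Opens ℂ := ⟨Metric.ball x (r + s / 2), Metric.isOpen_ball⟩
  have hU : Set.EqOn g' g U := by
    intro z hz
    have h1 : b z = 1 := b.one_of_mem_closedBall (Metric.ball_subset_closedBall hz)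
    simp only [g', h1, one_smul]
  have hsub : Metric.closedBall x r ⊆ U := Metric.closedBall_subset_ball (by linarith)
  have h := norm_dz_le_of_contDiff hg' x hr (M := M) (δ := δ)
    (fun w hw => by rw [hU (hsub hw)]; exact hM w hw)
    (fun w hw => by rw [dbar_congr hU (hsub hw)]; exact hδ w hw)
    (fun w hw => by rw [dbar_congr (dz_congr hU) (hsub hw)]; exact hδ' w hw)
  rwa [dz_congr hU (hsub (Metric.mem_closedBall_self hr.le))] at h

/-- The Cauchy estimate for `∂ⁿg/∂zⁿ`, from `n` steps of radius `r`. The bound `M` of `g` is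
multiplied by a constant only, which is what makes the growth exponent independent of `n`. -/
theorem norm_iterate_dz_le_of_closedBall {r δ : ℝ} (hr : 0 < r) (a : ℂ) (n : ℕ) {g : ℂ → ℂ}
    (hg : ContDiffOn ℝ ∞ g Ω) {M : ℝ} (hΩ : Metric.closedBall a (n * r) ⊆ Ω)
    (hM : ∀ w ∈ Metric.closedBall a (n * r), ‖g w‖ ≤ M)
    (hδ : ∀ w ∈ Metric.closedBall a (n * r), ∀ j ≤ n, ‖dbar (dz^[j] g) w‖ ≤ δ) :
    ‖(dz^[n] g) a‖ ≤ M / r ^ n + (∑ j ∈ Finset.range n, (1 + 2 * r) / r ^ j) * δ := by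
  induction n generalizing g M with
  | zero => simpa using hM a (by simp)
  | succ n ih =>
    have hle : (n : ℝ) * r ≤ (n + 1 : ℕ) * r := by
      push_cast
      linarith
    have hsub : Metric.closedBall a (n * r) ⊆ Metric.closedBall a ((n + 1 : ℕ) * r) :=
      Metric.closedBall_subset_closedBall hle
    have hball : ∀ z ∈ Metric.closedBall a (n * r),
        Metric.closedBall z r ⊆ Metric.closedBall a ((n + 1 : ℕ) * r) := by
      intro z hz
      refine Metric.closedBall_subset_closedBall' ?_
      have : dist z a ≤ n * r := hz
      push_cast
      linarith
    have h := ih (g := dz g) (M := M / r + (1 + 2 * r) * δ) (contDiffOn_dz hg)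
      (hsub.trans hΩ)
      (fun w hw => norm_dz_le hg w hr ((hball w hw).trans hΩ)
        (fun z hz => hM z (hball w hw hz)) (fun z hz => hδ z (hball w hw hz) 0 (by omega))
        (fun z hz => hδ z (hball w hw hz) 1 (by omega)))
      (fun w hw j hj => hδ w (hsub hw) (j + 1) (by omega))
    rw [Function.iterate_succ_apply]
    refine h.trans (le_of_eq ?_)
    rw [Finset.sum_range_succ]
    field_simp
    ring

/-- Taylor's formula in `z` for functions with small `∂g/∂z̄`. The `ℝ`-derivative of the remainder
is the remainder of `∂g/∂z` of one order less, up to `∂g/∂z̄`. -/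
theorem norm_sub_taylor_le {a : ℂ} {ρ δ M : ℝ} (hρ : ρ ≤ 1) (hΩ : Metric.closedBall a ρ ⊆ Ω)
    (m : ℕ) {g : ℂ → ℂ} (hg : ContDiffOn ℝ ∞ g Ω)
    (hM : ∀ w ∈ Metric.closedBall a ρ, ‖(dz^[m] g) w‖ ≤ M)
    (hδ : ∀ w ∈ Metric.closedBall a ρ, ∀ j ≤ m, ‖dbar (dz^[j] g) w‖ ≤ δ)
    {z : ℂ} (hz : z ∈ Metric.closedBall a ρ) :
    ‖g z - ∑ n ∈ Finset.range m, (dz^[n] g) a * (z - a) ^ n / (n.factorial : ℂ)‖ ≤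
      M * ‖z - a‖ ^ m + m * δ := by
  induction m generalizing g z with
  | zero => simpa using hM z hz
  | succ m ih =>
    have hza : ‖z - a‖ ≤ ρ := by simpa [dist_eq_norm] using hz
    have hsub : Metric.closedBall a ‖z - a‖ ⊆ Metric.closedBall a ρ :=
      Metric.closedBall_subset_closedBall hza
    have hδ0 : 0 ≤ δ := (norm_nonneg _).trans (hδ z hz 0 (by omega))
    have hM0 : 0 ≤ M := (norm_nonneg _).trans (hM z hz)
    let T : ℂ → ℂ := fun w =>
      g w - ∑ n ∈ Finset.range (m + 1), (dz^[n] g) a * (w - a) ^ n / (n.factorial : ℂ)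
    let S : ℂ → ℂ := fun w =>
      ∑ n ∈ Finset.range m, (dz^[n] (dz g)) a * (w - a) ^ n / (n.factorial : ℂ)
    have hder : ∀ w ∈ Metric.closedBall a ‖z - a‖,
        HasFDerivAt T
          (fderiv ℝ g w - (ContinuousLinearMap.toSpanSingleton ℂ (S w)).restrictScalars ℝ) w := by
      intro w hw
      have h1 : HasFDerivAt g (fderiv ℝ g w) w :=
        ((contDiffAt_of_mem hg (hΩ (hsub hw)) 1).differentiableAt (by simp)).hasFDerivAt
      have h2 : HasDerivAt (fun w : ℂ => ∑ n ∈ Finset.range (m + 1),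
          (dz^[n] g) a * (w - a) ^ n / (n.factorial : ℂ)) (S w) w := by
        have h3 : HasDerivAt (fun w : ℂ => ∑ n ∈ Finset.range (m + 1),
            (dz^[n] g) a * (w - a) ^ n / (n.factorial : ℂ)) (∑ n ∈ Finset.range (m + 1),
              (dz^[n] g) a * (n * (w - a) ^ (n - 1) * 1) / (n.factorial : ℂ)) w :=
          HasDerivAt.fun_sum fun n _ =>
            ((((hasDerivAt_id w).sub_const a).fun_pow n).const_mul _).div_const _
        convert h3 using 1
        rw [Finset.sum_range_succ']
        simp only [Nat.cast_zero, zero_mul, mul_zero, zero_div, add_zero, S]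
        refine Finset.sum_congr rfl fun n _ => ?_
        rw [Function.iterate_succ_apply, Nat.factorial_succ]
        have e1 : ((n : ℂ) + 1) ≠ 0 := by exact_mod_cast n.succ_ne_zero
        have e2 : (n.factorial : ℂ) ≠ 0 := by exact_mod_cast n.factorial_ne_zero
        push_cast
        field_simp
      exact h1.sub (h2.hasFDerivAt.restrictScalars ℝ)
    have hbound : ∀ w ∈ Metric.closedBall a ‖z - a‖,
        ‖fderiv ℝ g w - (ContinuousLinearMap.toSpanSingleton ℂ (S w)).restrictScalars ℝ‖ ≤
          M * ‖z - a‖ ^ m + m * δ + δ := by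
      intro w hw
      refine ContinuousLinearMap.opNorm_le_bound _ (by positivity) fun h => ?_
      have e : (fderiv ℝ g w - (ContinuousLinearMap.toSpanSingleton ℂ (S w)).restrictScalars ℝ) h =
          (dz g w - S w) * h + dbar g w * (starRingEnd ℂ) h := by
        rw [sub_apply, fderiv_apply_eq_dz_dbar]
        simp only [ContinuousLinearMap.coe_restrictScalars',
          ContinuousLinearMap.toSpanSingleton_apply, smul_eq_mul]
        ring
      have hw' := hsub hw
      have hwa : ‖w - a‖ ≤ ‖z - a‖ := by simpa [dist_eq_norm] using hw
      have h1 := ih (g := dz g) (contDiffOn_dz hg) (fun w hw => hM w hw)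
        (fun w hw j hj => hδ w hw (j + 1) (by omega)) hw'
      have h2 : M * ‖w - a‖ ^ m ≤ M * ‖z - a‖ ^ m := by gcongr
      have h3 : ‖dbar g w‖ ≤ δ := hδ w hw' 0 (by omega)
      rw [e, add_mul]
      refine (norm_add_le _ _).trans (add_le_add ?_ ?_)
      · rw [norm_mul]
        exact mul_le_mul_of_nonneg_right (h1.trans (by linarith)) (norm_nonneg _)
      · rw [norm_mul, RCLike.norm_conj]
        exact mul_le_mul_of_nonneg_right h3 (norm_nonneg _)
    have hmv := (convex_closedBall a ‖z - a‖).norm_image_sub_le_of_norm_hasFDerivWithin_le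
      (fun w hw => (hder w hw).hasFDerivWithinAt) hbound
      (Metric.mem_closedBall_self (norm_nonneg _)) (y := z) (by simp [dist_eq_norm])
    have hTa : T a = 0 := by
      simp only [T, sub_self, Finset.sum_range_succ']
      simp
    rw [hTa, sub_zero] at hmv
    refine hmv.trans ?_
    have h4 : ((m : ℝ) * δ + δ) * ‖z - a‖ ≤ (m * δ + δ) * 1 :=
      mul_le_mul_of_nonneg_left (hza.trans hρ) (by positivity)
    push_cast
    rw [pow_succ]
    linarith

end open_set

/-! ### Estimates for small `ε` -/

theorem exists_Ioo_iff_eventually {P : ℝ → Prop} :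
    (∃ η ∈ Set.Ioc (0 : ℝ) 1, ∀ ε ∈ Set.Ioo 0 η, P ε) ↔ ∀ᶠ ε in 𝓝[>] (0 : ℝ), P ε := by
  constructor
  · rintro ⟨η, hη, h⟩
    filter_upwards [Ioo_mem_nhdsGT hη.1] with ε hε using h ε hε
  · intro h
    obtain ⟨η, hη, hs⟩ := (mem_nhdsGT_iff_exists_Ioo_subset).1 h
    exact ⟨min η 1, ⟨lt_min hη one_pos, min_le_right _ _⟩,
      fun ε hε => hs ⟨hε.1, hε.2.trans_le (min_le_left _ _)⟩⟩

theorem eventually_pos_le_one : ∀ᶠ ε in 𝓝[>] (0 : ℝ), 0 < ε ∧ ε ≤ 1 := by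
  filter_upwards [Ioo_mem_nhdsGT (one_pos : (0 : ℝ) < 1)] with ε hε using ⟨hε.1, hε.2.le⟩

theorem tendsto_const_mul_rpow_zero (C : ℝ) {s : ℝ} (hs : 0 < s) :
    Filter.Tendsto (fun ε : ℝ => C * ε ^ s) (𝓝[>] 0) (𝓝 0) := by
  have h : Filter.Tendsto (fun ε : ℝ => C * ε ^ s) (𝓝 0) (𝓝 (C * 0 ^ s)) :=
    ((Real.continuousAt_rpow_const 0 s (Or.inr hs.le)).tendsto).const_mul C
  rw [Real.zero_rpow hs.ne', mul_zero] at h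
  exact h.mono_left nhdsWithin_le_nhds

/-! ### Holomorphic families of functions -/

section families

variable {Ω : TopologicalSpace.Opens ℂ}

theorem dz_moderate {u : A0 → ℂ → ℂ} (hu : FunModerate Ω u) :
    FunModerate Ω (fun φ => dz (u φ)) := by
  refine ⟨fun φ => contDiffOn_dz (hu.1 φ), fun K hK hKΩ n => ?_⟩
  exact ((isModerate_const ‖dzForm‖).mul (hu.2 K hK hKΩ (n + 1)) (fun _ _ => norm_nonneg dzForm)
    fun _ _ => norm_nonneg _).mono
      fun φ z hz => norm_iteratedFDeriv_dz_le (hu.1 φ) (hKΩ hz) n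

/-- `∂ⁿ/∂zⁿ` on representatives. -/
noncomputable def iterateDzRep (n : ℕ) (u : funModerate Ω) : funModerate Ω :=
  ⟨fun φ => dz^[n] (u.1 φ), by
    induction n with
    | zero => exact u.2
    | succ n ih =>
      simp only [Function.iterate_succ_apply']
      exact dz_moderate ih⟩

/-- Every representative of a holomorphic generalized function has negligible `∂/∂z̄`. -/
theorem dbarRep_mem_funNegligible {u : funModerate Ω}
    (hu : (GenFun.mk Ω u).IsHolomorphic) : dbarRep u ∈ funNegligible Ω :=
  Ideal.Quotient.eq_zero_iff_mem.1 hu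

/-- For holomorphic families, `∂/∂z̄` of the first `m` derivatives `∂ʲ/∂zʲ` is smaller than any
prescribed power of `ε`, because it is a derivative of the negligible family `∂u/∂z̄`. -/
theorem eventually_norm_dbar_iterate_dz_le {u : funModerate Ω} (hu : dbarRep u ∈ funNegligible Ω)
    {K : Set ℂ} (hK : IsCompact K) (hKΩ : K ⊆ Ω) (B : ℝ) (m : ℕ) :
    ∃ N : ℕ, ∀ φ ∈ A N, ∃ c : ℝ, 0 < c ∧ ∀ᶠ ε in 𝓝[>] (0 : ℝ), ∀ z ∈ K, ∀ j ≤ m,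
      ‖dbar (dz^[j] (u.1 (φ.scale ε))) z‖ ≤ c * ε ^ B := by
  have key : ∀ j, ∃ N : ℕ, ∀ φ ∈ A N, ∃ c : ℝ, 0 < c ∧ ∀ᶠ ε in 𝓝[>] (0 : ℝ), ∀ z ∈ K,
      ‖dbar (dz^[j] (u.1 (φ.scale ε))) z‖ ≤ c * ε ^ B := by
    intro j
    obtain ⟨N, γ, hγ, hN⟩ := hu K hK hKΩ j
    obtain ⟨q, hqN, hqB⟩ := ((Filter.eventually_ge_atTop N).and
      (hγ.2.2.eventually_ge_atTop (B + N))).exists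
    refine ⟨q, fun φ hφ => ?_⟩
    obtain ⟨c, hc, h⟩ := hN q hqN φ hφ
    have hp : 0 < ‖dzForm‖ ^ j + 1 := by positivity
    refine ⟨(‖dzForm‖ ^ j + 1) * c, by positivity, ?_⟩
    filter_upwards [exists_Ioo_iff_eventually.1 h, eventually_pos_le_one] with ε hε hε1 z hz
    have hs := u.2.1 (φ.scale ε)
    have h1 := norm_iterate_dz_le (contDiffOn_dbar hs) (hKΩ hz) j
    have h2 : ‖iteratedFDeriv ℝ j (dbar (u.1 (φ.scale ε))) z‖ ≤ c * ε ^ (γ q - N) := hε z hz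
    have h3 : ε ^ (γ q - N) ≤ ε ^ B :=
      Real.rpow_le_rpow_of_exponent_ge hε1.1 hε1.2 (by linarith)
    rw [dbar_iterate_dz_eqOn hs j (hKΩ hz)]
    refine h1.trans ?_
    rw [mul_assoc]
    exact mul_le_mul (by linarith) (h2.trans (mul_le_mul_of_nonneg_left h3 hc.le))
      (norm_nonneg _) hp.le
  induction m with
  | zero =>
    obtain ⟨N, hN⟩ := key 0
    refine ⟨N, fun φ hφ => ?_⟩
    obtain ⟨c, hc, h⟩ := hN φ hφ
    refine ⟨c, hc, h.mono fun ε hε z hz j hj => ?_⟩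
    obtain rfl : j = 0 := by omega
    exact hε z hz
  | succ m ih =>
    obtain ⟨N, hN⟩ := key (m + 1)
    obtain ⟨N', hN'⟩ := ih
    refine ⟨max N N', fun φ hφ => ?_⟩
    obtain ⟨c, hc, h⟩ := hN φ (A_anti (le_max_left _ _) hφ)
    obtain ⟨c', hc', h'⟩ := hN' φ (A_anti (le_max_right _ _) hφ)
    refine ⟨c + c', by positivity, ?_⟩
    filter_upwards [h, h', eventually_pos_le_one] with ε hε hε' hε1 z hz j hj
    have hp : 0 ≤ ε ^ B := Real.rpow_nonneg hε1.1.le _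
    rcases Nat.lt_or_ge m j with hj' | hj'
    · obtain rfl : j = m + 1 := by omega
      exact (hε z hz).trans (mul_le_mul_of_nonneg_right (by linarith) hp)
    · exact (hε' z hz j hj').trans (mul_le_mul_of_nonneg_right (by linarith) hp)

/-- The Cauchy estimates for a holomorphic generalized function: on a compact set, all the
derivatives `∂ⁿ/∂zⁿ` are `O(ε^(-L))` with an exponent `L` that does not depend on `n`. -/
theorem exists_uniform_exponent {u : funModerate Ω} (hu : dbarRep u ∈ funNegligible Ω)
    {K : Set ℂ} (hK : IsCompact K) (hKΩ : K ⊆ Ω) :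
    ∃ L : ℕ, ∀ n : ℕ, ∃ N : ℕ, ∀ φ ∈ A N, ∃ C : ℝ, 0 < C ∧ ∀ᶠ ε in 𝓝[>] (0 : ℝ), ∀ z ∈ K,
      ‖(dz^[n] (u.1 (φ.scale ε))) z‖ ≤ C * ε ^ (-(L : ℝ)) := by
  obtain ⟨ρ, hρ, hρΩ⟩ := hK.exists_cthickening_subset_open Ω.isOpen hKΩ
  obtain ⟨L, hL⟩ := u.2.2 _ hK.cthickening hρΩ 0
  refine ⟨L, fun n => ?_⟩
  obtain ⟨N, hN⟩ := eventually_norm_dbar_iterate_dz_le hu hK.cthickening hρΩ (-(L : ℝ)) n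
  refine ⟨max L N, fun φ hφ => ?_⟩
  obtain ⟨c, hc, h⟩ := hL φ (A_anti (le_max_left _ _) hφ)
  obtain ⟨d, hd, h'⟩ := hN φ (A_anti (le_max_right _ _) hφ)
  have hr : 0 < ρ / (n + 1) := by positivity
  -- `n` steps of this radius stay within distance `ρ` of `K`; `n + 1` avoids division by zero.
  set r := ρ / (n + 1) with hrdef
  have hnr : n * r ≤ ρ := by
    rw [hrdef, mul_div_assoc', div_le_iff₀ (by positivity)]
    linarith
  have hS : 0 ≤ ∑ j ∈ Finset.range n, (1 + 2 * r) / r ^ j :=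
    Finset.sum_nonneg fun j _ => by positivity
  refine ⟨c / r ^ n + (∑ j ∈ Finset.range n, (1 + 2 * r) / r ^ j) * d, by positivity, ?_⟩
  filter_upwards [exists_Ioo_iff_eventually.1 h, h'] with ε hε hε' z hz
  have hball : Metric.closedBall z (n * r) ⊆ Metric.cthickening ρ K :=
    (Metric.closedBall_subset_closedBall hnr).trans (Metric.closedBall_subset_cthickening hz ρ)
  refine (norm_iterate_dz_le_of_closedBall hr z n (u.2.1 (φ.scale ε))
    (M := c * ε ^ (-(L : ℝ))) (hball.trans hρΩ)
    (fun w hw => ?_) (fun w hw j hj => hε' w (hball hw) j hj)).trans (le_of_eq (by ring))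
  have h1 := hε w (hball hw)
  beta_reduce at h1
  rwa [norm_iteratedFDeriv_zero] at h1

/-- The uniform exponent `L` of the Cauchy estimates gives sub-linearity with `p_n = -L` and
`k = 1`. -/
theorem isSublinear_of_isHolomorphic {f : GenFun Ω} (hf : f.IsHolomorphic) : f.IsSublinear := by
  obtain ⟨u, rfl⟩ := Ideal.Quotient.mk_surjective f
  refine ⟨u, rfl, ?_⟩
  rintro _ ⟨v, rfl, hv⟩
  refine ⟨v, rfl, hv, ?_⟩
  obtain ⟨_, _, K, hK, hKΩ, p, hp⟩ := hv
  obtain ⟨L, hL⟩ := exists_uniform_exponent (dbarRep_mem_funNegligible hf) hK hKΩ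
  choose N hN using hL
  refine ⟨1, fun _ => -(L : ℝ), fun n => max (N n) p, ?_, fun n φ hφ => ?_⟩
  · simp only [one_mul]
    exact Filter.tendsto_atTop_add_const_left _ _ tendsto_natCast_atTop_atTop
  · obtain ⟨C, hC, h⟩ := hN n φ (A_anti (le_max_left _ _) hφ)
    refine ⟨C, hC, exists_Ioo_iff_eventually.2 ?_⟩
    filter_upwards [h, exists_Ioo_iff_eventually.1 (hp φ (A_anti (le_max_right _ _) hφ))]
      with ε h1 h2 using h1 _ h2

end families

/-! ### The valuation in terms of `ε` -/

theorem A0.tsupport_isCompact (φ : A0) : IsCompact (tsupport φ.1) := by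
  obtain ⟨χ, hχ, h⟩ := φ.2
  obtain ⟨R, hR⟩ := hχ.compact.isCompact.isBounded.subset_closedBall 0
  refine HasCompactSupport.intro (K := Metric.closedBall (0 : ℝ) R ×ℂ Metric.closedBall (0 : ℝ) R)
    ((isCompact_closedBall _ _).reProdIm (isCompact_closedBall _ _)) fun z hz => ?_
  rw [h]
  by_contra hne
  exact hz ⟨hR (subset_tsupport _ (left_ne_zero_of_mul hne)),
    hR (subset_tsupport _ (right_ne_zero_of_mul hne))⟩

/-- Positivity of `i(φ)` gives the powers `i(φ_ε)^(-r)` in the valuation their proper values, of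
order `ε^(-r)`. -/
theorem A0.diam_pos (φ : A0) : 0 < φ.diam := by
  obtain ⟨χ, hχ, h⟩ := φ.2
  obtain ⟨x, hx, hx0⟩ : ∃ x : ℝ, 0 < x ∧ χ x ≠ 0 := by
    by_contra! hc
    have h1 := hχ.mass
    rw [MeasureTheory.setIntegral_eq_zero_of_forall_eq_zero (t := Set.Ioi 0)
      fun x hx => hc x hx] at h1
    norm_num at h1
  have h1 : (⟨x, x⟩ : ℂ) ∈ tsupport φ.1 := subset_tsupport _ (by simp [h, hx0])
  have h2 : (⟨-x, -x⟩ : ℂ) ∈ tsupport φ.1 := subset_tsupport _ (by simp [h, hχ.even, hx0])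
  refine lt_of_lt_of_le (dist_pos.2 fun he => ?_)
    (Metric.dist_le_diam_of_mem φ.tsupport_isCompact.isBounded h1 h2)
  have : x = -x := congrArg Complex.re he
  linarith

open Pointwise in
theorem A0.diam_scale (φ : A0) {ε : ℝ} (hε : 0 < ε) : (φ.scale ε).diam = ε * φ.diam := by
  have hε' : (ε : ℂ) ≠ 0 := by exact_mod_cast hε.ne'
  have h1 : Function.support (φ.scale ε).1 = (ε : ℂ) • Function.support φ.1 := by
    ext z
    rw [Set.mem_smul_set_iff_inv_smul_mem₀ hε']
    simp [A0.scale, hε, hε.ne', div_eq_inv_mul]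
  unfold A0.diam tsupport
  rw [Metric.diam_closure, Metric.diam_closure, h1, diam_smul₀, Complex.norm_of_nonneg hε.le]

theorem GenNum.exists_rep_of_mem_expSet {x : GenNum} {r : ℝ} (hr : r ∈ x.expSet) :
    ∃ v : numModerate, GenNum.mk v = x ∧ ∃ p : ℕ, ∀ φ ∈ A p, ∃ C : ℝ, 0 < C ∧
      ∀ᶠ ε in 𝓝[>] (0 : ℝ), ‖v.1 (φ.scale ε)‖ ≤ C * ε ^ r := by
  obtain ⟨v, hv, p, hp⟩ := hr
  refine ⟨v, hv, p, fun φ hφ => ⟨φ.diam ^ r, Real.rpow_pos_of_pos φ.diam_pos _, ?_⟩⟩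
  have h := (hp φ hφ).norm.eventually_le_const (u := 1) (by simp)
  filter_upwards [h, eventually_pos_le_one] with ε h1 hε
  have hpos : 0 < ε * φ.diam := mul_pos hε.1 φ.diam_pos
  rw [φ.diam_scale hε.1, norm_mul, Complex.norm_of_nonneg (Real.rpow_nonneg hpos.le _),
    Real.rpow_neg hpos.le, inv_mul_le_iff₀ (Real.rpow_pos_of_pos hpos _), mul_one,
    Real.mul_rpow hε.1.le φ.diam_pos.le] at h1
  linarith

theorem GenNum.mem_expSet_mk {y : numModerate} {r s : ℝ} (hrs : r < s) (p : ℕ)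
    (h : ∀ φ ∈ A p, ∃ C : ℝ, ∀ᶠ ε in 𝓝[>] (0 : ℝ), ‖y.1 (φ.scale ε)‖ ≤ C * ε ^ s) :
    r ∈ (GenNum.mk y).expSet := by
  refine ⟨y, rfl, p, fun φ hφ => ?_⟩
  obtain ⟨C, hC⟩ := h φ hφ
  refine squeeze_zero_norm' ?_ (tendsto_const_mul_rpow_zero (φ.diam ^ (-r) * C) (sub_pos.2 hrs))
  filter_upwards [hC, eventually_pos_le_one] with ε h1 hε
  have hpos : 0 < ε * φ.diam := mul_pos hε.1 φ.diam_pos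
  rw [φ.diam_scale hε.1, norm_mul, Complex.norm_of_nonneg (Real.rpow_nonneg hpos.le _)]
  refine (mul_le_mul_of_nonneg_left h1 (Real.rpow_nonneg hpos.le _)).trans (le_of_eq ?_)
  rw [Real.mul_rpow hε.1.le φ.diam_pos.le, sub_eq_neg_add, Real.rpow_add hε.1]
  ring

theorem GenNum.exists_pos_mem_expSet {x : GenNum} (hx : x.sharpNorm < 1) :
    ∃ r ∈ x.expSet, 0 < r := by
  rw [GenNum.sharpNorm, EReal.exp_lt_one_iff, EReal.neg_lt_comm, neg_zero] at hx
  obtain ⟨_, ⟨r, hr, rfl⟩, h⟩ := lt_sSup_iff.1 hx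
  exact ⟨r, hr, EReal.coe_pos.1 h⟩

theorem GenNum.sharpNorm_le_of_mem_expSet {x : GenNum} {r : ℝ} (hr : r ∈ x.expSet) :
    x.sharpNorm ≤ ENNReal.ofReal (Real.exp (-r)) := by
  rw [GenNum.sharpNorm, ← EReal.exp_coe, EReal.exp_le_exp_iff, EReal.coe_neg,
    EReal.neg_le_neg_iff]
  exact le_sSup ⟨r, hr, rfl⟩

theorem GenNum.tendsto_sharpNorm_zero {x : ℕ → GenNum}
    (h : ∀ r : ℝ, ∀ᶠ m in Filter.atTop, r ∈ (x m).expSet) :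
    Filter.Tendsto (fun m => (x m).sharpNorm) Filter.atTop (𝓝 0) := by
  rw [ENNReal.tendsto_nhds_zero]
  intro e he
  rcases eq_or_ne e ⊤ with rfl | he'
  · simp
  filter_upwards [h (-Real.log e.toReal)] with m hm
  refine (GenNum.sharpNorm_le_of_mem_expSet hm).trans (le_of_eq ?_)
  rw [neg_neg, Real.exp_log (ENNReal.toReal_pos he.ne' he'), ENNReal.ofReal_toReal he']

theorem mem_numNegligible_of_eventually_eq_zero {x : numModerate} (p : ℕ)
    (h : ∀ φ ∈ A p, ∀ᶠ ε in 𝓝[>] (0 : ℝ), x.1 (φ.scale ε) = 0) : x ∈ numNegligible := by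
  refine ⟨p, _, natCast_mem_Gam, fun q hq φ hφ => ⟨1, one_pos, exists_Ioo_iff_eventually.2 ?_⟩⟩
  filter_upwards [h φ (A_anti hq hφ), eventually_pos_le_one] with ε h1 hε _ _
  rw [h1, norm_zero, one_mul]
  exact Real.rpow_nonneg hε.1.le _

/-! ### Taylor expansion of point values -/

section analytic

variable {Ω : TopologicalSpace.Opens ℂ}

theorem taylorCoeff_moderate (u : funModerate Ω) {x : A0 → ℂ} (hx : IsCompactlySupportedPt Ω x)
    (n : ℕ) : NumModerate (fun φ => (dz^[n] (u.1 φ)) (x φ) / (n.factorial : ℂ)) := by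
  refine IsModerate.mono (pointValue_moderate (iterateDzRep n u) hx) fun φ _ _ => ?_
  rw [norm_div, Complex.norm_natCast]
  exact div_le_self (norm_nonneg _) (by exact_mod_cast n.factorial_pos)

/-- The generalized number `∂ⁿf/∂zⁿ(x) / n!`, on representatives. -/
noncomputable def taylorCoeff (u : funModerate Ω) {x : A0 → ℂ} (hx : IsCompactlySupportedPt Ω x)
    (n : ℕ) : numModerate :=
  ⟨fun φ => (dz^[n] (u.1 φ)) (x φ) / (n.factorial : ℂ), taylorCoeff_moderate u hx n⟩

/-- A generalized number at distance less than `1` from a compactly supported point is represented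
by a family that stays in a given compact neighbourhood of the support. -/
theorem exists_rep_near {K K' : Set ℂ} {ρ : ℝ} (hρ : 0 < ρ) (hK' : IsCompact K')
    (hK'Ω : K' ⊆ Ω) (hKK' : Metric.cthickening ρ K ⊆ K') {v : numModerate}
    (hvΩ : ∀ φ, v.1 φ ∈ Ω) {p : ℕ}
    (hp : ∀ φ ∈ A p, ∀ᶠ ε in 𝓝[>] (0 : ℝ), v.1 (φ.scale ε) ∈ K) {z : GenNum}
    (hz : (z - GenNum.mk v).sharpNorm < 1) :
    ∃ w : numModerate, GenNum.mk w = z ∧ IsCompactlySupportedPt Ω w.1 ∧ ∃ r : ℝ, 0 < r ∧ ∃ q : ℕ,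
      ∀ φ ∈ A q, ∃ C : ℝ, 0 < C ∧
        ∀ᶠ ε in 𝓝[>] (0 : ℝ), ‖w.1 (φ.scale ε) - v.1 (φ.scale ε)‖ ≤ C * ε ^ r := by
  classical
  obtain ⟨r, hr, hr0⟩ := GenNum.exists_pos_mem_expSet hz
  obtain ⟨d, hd, q, hq⟩ := GenNum.exists_rep_of_mem_expSet hr
  have hfun : NumModerate fun φ => if v.1 φ + d.1 φ ∈ K' then v.1 φ + d.1 φ else v.1 φ := by
    have h1 : IsModerate (Set.univ : Set Unit) (fun φ _ => ‖v.1 φ‖) := v.2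
    have h2 : IsModerate (Set.univ : Set Unit) (fun φ _ => ‖d.1 φ‖) := d.2
    refine (h1.add h2).mono fun φ _ _ => ?_
    dsimp only
    split_ifs
    · exact norm_add_le _ _
    · exact le_add_of_nonneg_right (norm_nonneg _)
  let w : numModerate :=
    ⟨fun φ => if v.1 φ + d.1 φ ∈ K' then v.1 φ + d.1 φ else v.1 φ, hfun⟩
  have hw : ∀ φ, w.1 φ = if v.1 φ + d.1 φ ∈ K' then v.1 φ + d.1 φ else v.1 φ := fun _ => rfl
  -- Along `φ_ε`, the family `v + d` enters `K'`, so that `w` agrees with it for small `ε`.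
  have hev : ∀ φ ∈ A (max p q), ∀ᶠ ε in 𝓝[>] (0 : ℝ),
      v.1 (φ.scale ε) + d.1 (φ.scale ε) ∈ K' := by
    intro φ hφ
    obtain ⟨C, _, h⟩ := hq φ (A_anti (le_max_right _ _) hφ)
    filter_upwards [hp φ (A_anti (le_max_left _ _) hφ), h,
      (tendsto_const_mul_rpow_zero C hr0).eventually_le_const hρ] with ε h1 h2 h3
    refine hKK' (Metric.closedBall_subset_cthickening h1 ρ ?_)
    rw [Metric.mem_closedBall, dist_eq_norm, add_sub_cancel_left]
    exact h2.trans h3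
  refine ⟨w, ?_, ⟨w.2, fun φ => ?_, K', hK', hK'Ω, max p q, fun φ hφ => ?_⟩,
    r, hr0, max p q, fun φ hφ => ?_⟩
  · have h1 : GenNum.mk w = GenNum.mk (v + d) := by
      rw [Ideal.Quotient.mk_eq_mk_iff_sub_mem]
      refine mem_numNegligible_of_eventually_eq_zero (max p q) fun φ hφ => ?_
      filter_upwards [hev φ hφ] with ε hε
      change w.1 (φ.scale ε) - (v.1 (φ.scale ε) + d.1 (φ.scale ε)) = 0
      rw [hw, if_pos hε, sub_self]
    rw [h1, GenNum.mk, map_add]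
    change GenNum.mk v + GenNum.mk d = z
    rw [hd, add_sub_cancel]
  · rw [hw]
    split_ifs with h
    · exact hK'Ω h
    · exact hvΩ φ
  · refine exists_Ioo_iff_eventually.2 ((hev φ hφ).mono fun ε hε => ?_)
    rwa [hw, if_pos hε]
  · obtain ⟨C, hC, h⟩ := hq φ (A_anti (le_max_right _ _) hφ)
    refine ⟨C, hC, ?_⟩
    filter_upwards [hev φ hφ, h] with ε h1 h2
    rwa [hw, if_pos h1, add_sub_cancel_left]

/-- The Taylor remainder of order `m` is `O(ε^s)` as soon as `s ≤ r m - L`. -/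
theorem exists_taylor_remainder_le {u : funModerate Ω} (hu : dbarRep u ∈ funNegligible Ω)
    {K : Set ℂ} {ρ : ℝ} (hρ : 0 < ρ) (hρ1 : ρ ≤ 1) (hK : IsCompact K)
    (hKΩ : Metric.cthickening ρ K ⊆ Ω) {L : ℕ}
    (hL : ∀ n : ℕ, ∃ N : ℕ, ∀ φ ∈ A N, ∃ C : ℝ, 0 < C ∧ ∀ᶠ ε in 𝓝[>] (0 : ℝ),
      ∀ z ∈ Metric.cthickening ρ K, ‖(dz^[n] (u.1 (φ.scale ε))) z‖ ≤ C * ε ^ (-(L : ℝ)))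
    {v w : A0 → ℂ} {p q : ℕ} {r : ℝ} (hr : 0 < r)
    (hv : ∀ φ ∈ A p, ∀ᶠ ε in 𝓝[>] (0 : ℝ), v (φ.scale ε) ∈ K)
    (hw : ∀ φ ∈ A q, ∃ C : ℝ, 0 < C ∧
      ∀ᶠ ε in 𝓝[>] (0 : ℝ), ‖w (φ.scale ε) - v (φ.scale ε)‖ ≤ C * ε ^ r)
    {s : ℝ} {m : ℕ} (hm : s ≤ r * m - L) :
    ∃ N : ℕ, ∀ φ ∈ A N, ∃ C : ℝ, ∀ᶠ ε in 𝓝[>] (0 : ℝ),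
      ‖u.1 (φ.scale ε) (w (φ.scale ε)) - ∑ n ∈ Finset.range m,
        (dz^[n] (u.1 (φ.scale ε))) (v (φ.scale ε)) * (w (φ.scale ε) - v (φ.scale ε)) ^ n /
          (n.factorial : ℂ)‖ ≤ C * ε ^ s := by
  obtain ⟨N₁, h₁⟩ := hL m
  obtain ⟨N₂, h₂⟩ := eventually_norm_dbar_iterate_dz_le hu hK.cthickening hKΩ s m
  refine ⟨max (max N₁ N₂) (max p q), fun φ hφ => ?_⟩
  obtain ⟨C, hC, hC'⟩ := h₁ φ (A_anti ((le_max_left _ _).trans (le_max_left _ _)) hφ)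
  obtain ⟨c, hc, hc'⟩ := h₂ φ (A_anti ((le_max_right _ _).trans (le_max_left _ _)) hφ)
  obtain ⟨D, hD, hD'⟩ := hw φ (A_anti ((le_max_right _ _).trans (le_max_right _ _)) hφ)
  refine ⟨C * D ^ m + m * c, ?_⟩
  filter_upwards [hC', hc', hD', hv φ (A_anti ((le_max_left _ _).trans (le_max_right _ _)) hφ),
    eventually_pos_le_one, (tendsto_const_mul_rpow_zero D hr).eventually_le_const hρ]
    with ε e1 e2 e3 e4 hε e5
  have hball := Metric.closedBall_subset_cthickening e4 ρ
  have h := norm_sub_taylor_le hρ1 (hball.trans hKΩ) m (u.2.1 (φ.scale ε))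
    (fun z hz => e1 z (hball hz)) (fun z hz => e2 z (hball hz)) (z := w (φ.scale ε))
    (by rw [Metric.mem_closedBall, dist_eq_norm]; exact e3.trans e5)
  refine h.trans ?_
  have h1 : ‖w (φ.scale ε) - v (φ.scale ε)‖ ^ m ≤ D ^ m * ε ^ (r * m) := by
    rw [Real.rpow_mul_natCast hε.1.le, ← mul_pow]
    exact pow_le_pow_left₀ (norm_nonneg _) e3 m
  have h2 : ε ^ (-(L : ℝ)) * ε ^ (r * m) ≤ ε ^ s := by
    rw [← Real.rpow_add hε.1]
    exact Real.rpow_le_rpow_of_exponent_ge hε.1 hε.2 (by linarith)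
  have h3 : 0 ≤ C * ε ^ (-(L : ℝ)) := mul_nonneg hC.le (Real.rpow_nonneg hε.1.le _)
  calc C * ε ^ (-(L : ℝ)) * ‖w (φ.scale ε) - v (φ.scale ε)‖ ^ m + m * (c * ε ^ s)
      ≤ C * ε ^ (-(L : ℝ)) * (D ^ m * ε ^ (r * m)) + m * (c * ε ^ s) := by gcongr
    _ = C * D ^ m * (ε ^ (-(L : ℝ)) * ε ^ (r * m)) + m * c * ε ^ s := by ring
    _ ≤ C * D ^ m * ε ^ s + m * c * ε ^ s := by gcongr
    _ = _ := by ring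

/-- Around each point, `κ(f)` is the sum of its Taylor series on the ball of radius `1`. -/
theorem isAnalytic_kappa_of_isHolomorphic {f : GenFun Ω} (hf : f.IsHolomorphic) :
    IsAnalytic (compactPts Ω) (kappa f) := by
  obtain ⟨u, rfl⟩ := Ideal.Quotient.mk_surjective f
  have hu := dbarRep_mem_funNegligible hf
  rintro ⟨_, v, rfl, hv⟩
  obtain ⟨_, hvΩ, K, hK, hKΩ, p, hp⟩ := id hv
  replace hp : ∀ φ ∈ A p, ∀ᶠ ε in 𝓝[>] (0 : ℝ), v.1 (φ.scale ε) ∈ K := fun φ hφ =>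
    exists_Ioo_iff_eventually.1 (hp φ hφ)
  obtain ⟨ρ, hρ, hρ1, hρΩ⟩ : ∃ ρ : ℝ, 0 < ρ ∧ ρ ≤ 1 ∧ Metric.cthickening ρ K ⊆ Ω := by
    obtain ⟨ρ, hρ, h⟩ := hK.exists_cthickening_subset_open Ω.isOpen hKΩ
    exact ⟨min ρ 1, lt_min hρ one_pos, min_le_right _ _,
      (Metric.cthickening_mono (min_le_left _ _) K).trans h⟩
  obtain ⟨L, hL⟩ := exists_uniform_exponent hu hK.cthickening hρΩ
  refine ⟨fun n => GenNum.mk (taylorCoeff u hv n), 1, one_pos, fun z hz => ?_⟩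
  rw [ENNReal.ofReal_one] at hz
  obtain ⟨w, rfl, hw, r, hr, q, hq⟩ :=
    exists_rep_near hρ hK.cthickening hρΩ subset_rfl hvΩ hp hz
  refine ⟨⟨w, rfl, hw⟩, GenNum.tendsto_sharpNorm_zero fun s => ?_⟩
  have ht : Filter.Tendsto (fun m : ℕ => r * (m : ℝ) - L) Filter.atTop Filter.atTop :=
    Filter.tendsto_atTop_add_const_right _ _
      (tendsto_natCast_atTop_atTop.const_mul_atTop hr)
  filter_upwards [ht.eventually_ge_atTop (s + 1)] with m hm
  obtain ⟨N, hN⟩ := exists_taylor_remainder_le hu hρ hρ1 hK hρΩ hL hr hp hq hm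
  let y : numModerate := (∑ n ∈ Finset.range m, taylorCoeff u hv n * (w - v) ^ n) -
    ⟨fun φ => u.1 φ (w.1 φ), pointValue_moderate u hw⟩
  have hy : GenNum.mk y = (∑ n ∈ Finset.range m, GenNum.mk (taylorCoeff u hv n) *
      (GenNum.mk w - GenNum.mk v) ^ n) - kappa (GenFun.mk Ω u) ⟨GenNum.mk w, w, rfl, hw⟩ := by
    rw [kappa_mk u w hw]
    simp only [y, pointValue, GenNum.mk, map_sub, map_sum, map_mul, map_pow]
  have hyφ : ∀ φ, y.1 φ = (∑ n ∈ Finset.range m, (dz^[n] (u.1 φ)) (v.1 φ) *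
      (w.1 φ - v.1 φ) ^ n / (n.factorial : ℂ)) - u.1 φ (w.1 φ) := by
    intro φ
    have h1 : y.1 φ = (∑ n ∈ Finset.range m, taylorCoeff u hv n * (w - v) ^ n).1 φ -
        u.1 φ (w.1 φ) := rfl
    rw [h1, AddSubmonoidClass.coe_finsetSum, Finset.sum_apply]
    refine congrArg (· - u.1 φ (w.1 φ)) (Finset.sum_congr rfl fun n _ => ?_)
    have h2 : (taylorCoeff u hv n * (w - v) ^ n).1 φ =
        (dz^[n] (u.1 φ)) (v.1 φ) / (n.factorial : ℂ) * (w.1 φ - v.1 φ) ^ n := rfl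
    rw [h2]
    ring
  rw [← hy]
  refine GenNum.mem_expSet_mk (lt_add_one s) N fun φ hφ => ?_
  obtain ⟨C, hC⟩ := hN φ hφ
  refine ⟨C, hC.mono fun ε hε => ?_⟩
  rwa [hyφ, norm_sub_rev]

end analytic

end Colombeau

theorem mainTheorem5 (Ω : TopologicalSpace.Opens ℂ) (hΩ : (Ω : Set ℂ).Nonempty)
    (f : Colombeau.GenFun Ω) (hf : f.IsHolomorphic) :
    Colombeau.IsAnalytic (Colombeau.compactPts Ω) (Colombeau.kappa f) ↔ f.IsSublinear :=
  ⟨fun _ => Colombeau.isSublinear_of_isHolomorphic hf,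
    fun _ => Colombeau.isAnalytic_kappa_of_isHolomorphic hf⟩
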